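/- Theorem 1.3. Let $G$ be a finite simple graph with maximum degree $\Delta(G) = 5$. Then $G$ has a strong edge-coloring with (at most) 37 colors; that is, there is a map $c : E(G) \to \{1, \dots, 37\}$ such that $c(e) \neq c(f)$ for any two distinct edges $e, f$ that share an endpoint or for which some endpoint of $e$ is adjacent in $G$ to some endpoint of $f$. -/

import Mathlib

/-- Two edges of `G` are at distance at most two when they share an endpoint or some endpoint of one
is adjacent in `G` to some endpoint of the other. -/
def SimpleGraph.EdgesWithinTwo {V : Type*} (G : SimpleGraph V) (e f : Sym2 V) : Prop :=
  ∃ x ∈ e, ∃ y ∈ f, x = y ∨ G.Adj x y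

/-- A strong edge-coloring: an assignment of colors to the edges of `G` such that no two distinct
edges at distance at most two receive the same color. -/
def SimpleGraph.EdgeLabeling.IsStrong {V : Type*} {G : SimpleGraph V} {K : Type*}
    (c : G.EdgeLabeling K) : Prop :=
  ∀ e f : G.edgeSet, e ≠ f → G.EdgesWithinTwo (e : Sym2 V) (f : Sym2 V) → c e ≠ c f

open Finset

/-! An edge `uv` has at most 8 further neighbors at its ends, so at most 40 edges lie near it. In a
connected graph, color greedily towards a root: a non-root edge has an adjacent vertex closer to the
root whose edges are all colored later, which leaves at most 35 conflicts (`exists_closer_vertex`).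
Only the edges at the root are a problem. They are harmless if the root has degree at most 4, or if
it lies on a triangle whose edges are colored last.

There remain triangle-free 5-regular graphs. Precolor a matching of edges joining neighbors of the
root `x` to vertices other than `x`, repeating colors so as to save `s` of them, color the other
edges away from `x` greedily, and color the five edges at `x` last by Hall's theorem
(`exists_coloring_of_root`). The edge `xv` then has at least `rootWeight x v + s - 3` free colors.
The weight sums, over the neighbors of `v` other than `x`, their codegrees (numbers of common
neighbors) with `x`; it is at least 4 and grows with 4-cycles through `xv`.

The proof splits on the largest codegree. Large codegree makes the weights large; small codegree
leaves room for many far-apart edges to share colors. The savings used are 0 for codegree 5, 1 for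
4, 1 or 2 for 3, 2 or 3 for 2, and 4 for at most 1. -/

/-- The map `c` gives different values to any two distinct elements of `S` related by `R`. -/
def ProperOn {W K : Type*} (R : W → W → Prop) (S : Finset W) (c : W → K) : Prop :=
  ∀ e ∈ S, ∀ f ∈ S, e ≠ f → R e f → c e ≠ c f

/-! ### Greedy coloring and Hall's theorem. -/

open Classical in
/-- Greedy extension of a partial coloring in decreasing order of rank. -/
theorem ProperOn.greedy_extend {W : Type*} [DecidableEq W] {k : ℕ} {R : W → W → Prop}
    (hR : ∀ e f, R e f → R f e) {S : Finset W} {c : W → Fin k} (hc : ProperOn R S c)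
    (ρ : W → ℕ) (T : Finset W) (hST : S ⊆ T)
    (h : ∀ e ∈ T, e ∉ S → #{f ∈ T | f ≠ e ∧ R e f ∧ (f ∈ S ∨ ρ e ≤ ρ f)} < k) :
    ∃ c' : W → Fin k, ProperOn R T c' ∧ ∀ e ∈ S, c' e = c e := by
  induction hn : #(T \ S) generalizing T with
  | zero =>
    have hTS : T ⊆ S := by
      rwa [Finset.card_eq_zero, sdiff_eq_empty_iff_subset] at hn
    exact ⟨c, fun e he f hf => hc e (hTS he) f (hTS hf), fun _ _ => rfl⟩
  | succ n ih =>
    have hne : (T \ S).Nonempty := by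
      rw [← Finset.card_pos]; omega
    -- An element of least rank is colored last, so all its conflicts outside `S` have rank at least
    -- its own.
    obtain ⟨e, he, hmin⟩ := Finset.exists_min_image (T \ S) ρ hne
    rw [mem_sdiff] at he
    have hST' : S ⊆ T.erase e := fun f hf =>
      mem_erase.2 ⟨fun hfe => he.2 (hfe ▸ hf), hST hf⟩
    obtain ⟨c', hc', hcS⟩ := ih (T.erase e) hST'
      (fun f hf hfS => lt_of_le_of_lt
        (card_le_card (filter_subset_filter _ (erase_subset _ _))) (h f (mem_of_mem_erase hf) hfS))
      (by rw [erase_sdiff_comm, card_erase_of_mem (mem_sdiff.2 he), hn]; rfl)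
    obtain ⟨a, ha⟩ : ∃ a : Fin k,
        a ∉ ({f ∈ T | f ≠ e ∧ R e f ∧ (f ∈ S ∨ ρ e ≤ ρ f)} : Finset W).image c' := by
      by_contra! hall
      have := card_le_card (s := (univ : Finset (Fin k))) (fun a _ => hall a)
      have h2 := h e he.1 he.2
      have h3 := this.trans card_image_le
      rw [card_univ, Fintype.card_fin] at h3
      omega
    have key : ∀ f ∈ T, f ≠ e → R e f → c' f ≠ a := by
      intro f hf hfe hRf hfa
      refine ha (mem_image.2 ⟨f, mem_filter.2 ⟨hf, hfe, hRf, ?_⟩, hfa⟩)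
      by_cases hfS : f ∈ S
      · exact Or.inl hfS
      · exact Or.inr (hmin f (mem_sdiff.2 ⟨hf, hfS⟩))
    refine ⟨Function.update c' e a, ?_, ?_⟩
    · intro f hf g hg hfg hRfg
      by_cases hfe : f = e
      · subst hfe
        rw [Function.update_self, Function.update_of_ne hfg.symm]
        exact (key g hg hfg.symm hRfg).symm
      · by_cases hge : g = e
        · subst hge
          rw [Function.update_self, Function.update_of_ne hfg]
          exact key f hf hfg (hR _ _ hRfg)
        · rw [Function.update_of_ne hfe, Function.update_of_ne hge]
          exact hc' f (mem_erase.2 ⟨hfe, hf⟩) g (mem_erase.2 ⟨hge, hg⟩) hfg hRfg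
    · intro f hf
      rw [Function.update_of_ne (by rintro rfl; exact he.2 hf)]
      exact hcS f hf

/-- A system of distinct representatives from Hall's theorem, when for every `m` there are
fewer than `m` sets with fewer than `m` elements. -/
theorem exists_injective_of_card_filter_lt {ι α : Type*} [Fintype ι] [DecidableEq α]
    (L : ι → Finset α) (h : ∀ m, 0 < m → m ≤ Fintype.card ι → #{i | #(L i) < m} < m) :
    ∃ f : ι → α, Function.Injective f ∧ ∀ i, f i ∈ L i := by
  refine (Finset.all_card_le_biUnion_card_iff_exists_injective L).1 fun S => ?_
  by_contra! hlt
  have h0 : 0 < #S := by omega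
  have := h #S h0 S.card_le_univ
  refine absurd (card_le_card (s := S) fun i hi => ?_) (not_le.2 this)
  rw [mem_filter]
  exact ⟨mem_univ _, (card_le_card (subset_biUnion_of_mem L hi)).trans_lt hlt⟩

/-! ### Edges near an edge, and distance to a root. -/

namespace SimpleGraph

variable {V : Type*}

theorem EdgesWithinTwo.symm {G : SimpleGraph V} {e f : Sym2 V} (h : G.EdgesWithinTwo e f) :
    G.EdgesWithinTwo f e := by
  obtain ⟨x, hx, y, hy, hxy⟩ := h
  exact ⟨y, hy, x, hx, hxy.imp Eq.symm Adj.symm⟩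

/-- The sum of the distances of the endpoints of an edge from a root. -/
noncomputable def edgeRank (G : SimpleGraph V) (r : V) : Sym2 V → ℕ :=
  Sym2.lift ⟨fun a b => G.dist r a + G.dist r b, fun _ _ => add_comm _ _⟩

@[simp] theorem edgeRank_mk (G : SimpleGraph V) (r a b : V) :
    G.edgeRank r s(a, b) = G.dist r a + G.dist r b := rfl

theorem Connected.exists_adj_dist_lt {G : SimpleGraph V} (hG : G.Connected) {r u : V}
    (hu : u ≠ r) : ∃ p, G.Adj u p ∧ G.dist r u = G.dist r p + 1 := by
  obtain ⟨w, hw⟩ := hG.exists_walk_length_eq_dist u r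
  cases w with
  | nil => exact absurd rfl hu
  | @cons _ p _ hadj w' =>
    refine ⟨p, hadj, le_antisymm ?_ ?_⟩
    · have := hG.dist_triangle (u := r) (v := p) (w := u)
      rwa [dist_eq_one_iff_adj.2 hadj.symm] at this
    · rw [Walk.length_cons] at hw
      rw [dist_comm, dist_comm (u := r)]
      have := dist_le w'
      omega

variable [Fintype V] [DecidableEq V] (G : SimpleGraph V) [DecidableRel G.Adj]

open Classical in
/-- The edges of `G` other than `e` at distance at most two from `e`. -/
noncomputable def nearEdges (e : Sym2 V) : Finset (Sym2 V) :=
  {f ∈ G.edgeFinset | f ≠ e ∧ G.EdgesWithinTwo e f}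

variable {G}

theorem mem_nearEdges {e f : Sym2 V} :
    f ∈ G.nearEdges e ↔ f ∈ G.edgeFinset ∧ f ≠ e ∧ G.EdgesWithinTwo e f := by
  simp [nearEdges]

/-- The neighbors of the ends of the edge `uv`, other than `u` and `v`. -/
def edgeNeighbors (G : SimpleGraph V) [DecidableRel G.Adj] (u v : V) : Finset V :=
  (G.neighborFinset u).erase v ∪ (G.neighborFinset v).erase u

theorem nearEdges_subset {u v : V} (huv : G.Adj u v) {f : Sym2 V}
    (hf : f ∈ G.nearEdges s(u, v)) :
    ∃ y ∈ G.edgeNeighbors u v, f ∈ G.incidenceFinset y := by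
  rw [mem_nearEdges, mem_edgeFinset] at hf
  obtain ⟨hfe, hne, a, ha, b, hb, hab⟩ := hf
  have main : ∀ u v, G.Adj u v → f ≠ s(u, v) → u ∈ f →
      ∃ y ∈ G.edgeNeighbors u v, f ∈ G.incidenceFinset y := by
    intro u v huv hne hu
    obtain ⟨c, rfl⟩ := hu
    refine ⟨c, ?_, ?_⟩
    · rw [edgeNeighbors, mem_union, mem_erase, mem_neighborFinset]
      exact Or.inl ⟨fun h => hne (h ▸ rfl), hfe⟩
    · rw [mem_incidenceFinset]
      exact ⟨hfe, Sym2.mem_mk_right _ _⟩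
  have comm : ∀ u v, G.edgeNeighbors u v = G.edgeNeighbors v u := fun u v => union_comm _ _
  have main' : ∀ u v, G.Adj u v → f ≠ s(u, v) → ∀ b ∈ f, u = b ∨ G.Adj u b →
      ∃ y ∈ G.edgeNeighbors u v, f ∈ G.incidenceFinset y := by
    rintro u v huv hne b hb (rfl | hub)
    · exact main u v huv hne hb
    · by_cases hbv : b = v
      · subst hbv
        rw [comm]
        exact main b u huv.symm (by rwa [Sym2.eq_swap]) hb
      · refine ⟨b, ?_, ?_⟩
        · rw [edgeNeighbors, mem_union, mem_erase, mem_neighborFinset]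
          exact Or.inl ⟨hbv, hub⟩
        · rw [mem_incidenceFinset]
          exact ⟨hfe, hb⟩
  rcases Sym2.mem_iff.1 ha with rfl | rfl
  · exact main' _ _ huv hne b hb hab
  · rw [comm]
    exact main' _ _ huv.symm (by rwa [Sym2.eq_swap]) b hb hab

theorem card_edgeNeighbors_le {u v : V} (huv : G.Adj u v) :
    #(G.edgeNeighbors u v) ≤ G.degree u - 1 + (G.degree v - 1) := by
  refine (card_union_le _ _).trans ?_
  rw [card_erase_of_mem (by simpa using huv), card_erase_of_mem (by simpa using huv.symm),
    card_neighborFinset_eq_degree, card_neighborFinset_eq_degree]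

theorem card_biUnion_incidenceFinset_le (hΔ : ∀ v, G.degree v ≤ 5) (Y : Finset V) :
    #(Y.biUnion fun y => G.incidenceFinset y) ≤ #Y * 5 :=
  card_biUnion_le_card_mul _ _ _ fun y _ => by
    rw [card_incidenceFinset_eq_degree]; exact hΔ y

theorem card_nearEdges_le (hΔ : ∀ v, G.degree v ≤ 5) {u v : V} (huv : G.Adj u v) :
    #(G.nearEdges s(u, v)) ≤ #(G.edgeNeighbors u v) * 5 := by
  refine (card_le_card fun f hf => ?_).trans (card_biUnion_incidenceFinset_le hΔ _)
  rw [mem_biUnion]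
  exact nearEdges_subset huv hf

theorem card_nearEdges_le_of_triangle (hΔ : ∀ v, G.degree v ≤ 5) {u v w : V} (huv : G.Adj u v)
    (huw : G.Adj u w) (hvw : G.Adj v w) : #(G.nearEdges s(u, v)) ≤ 35 := by
  have h1 := card_nearEdges_le hΔ huv
  have h2 : #(G.edgeNeighbors u v) ≤ 7 := by
    have h3 := card_union_add_card_inter ((G.neighborFinset u).erase v)
      ((G.neighborFinset v).erase u)
    rw [card_erase_of_mem (by simpa using huv), card_erase_of_mem (by simpa using huv.symm),
      card_neighborFinset_eq_degree, card_neighborFinset_eq_degree] at h3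
    have h4 : 0 < #((G.neighborFinset u).erase v ∩ (G.neighborFinset v).erase u) := by
      refine card_pos.2 ⟨w, ?_⟩
      simp [huw, hvw, huw.ne']
    have := hΔ u
    have := hΔ v
    unfold edgeNeighbors
    omega
  omega

/-- For an edge `e` away from the root there is a vertex `p` whose incident edges are all closer to
the root than `e`, such that at most 35 other edges are near `e`. -/
theorem exists_closer_vertex (hG : G.Connected) (hΔ : ∀ v, G.degree v ≤ 5) {r : V} {e : Sym2 V}
    (he : e ∈ G.edgeSet) (hr : r ∉ e) :
    ∃ p, (∀ f ∈ G.incidenceFinset p, G.edgeRank r f < G.edgeRank r e) ∧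
      #(G.nearEdges e \ G.incidenceFinset p) ≤ 35 := by
  have main : ∀ u v, G.Adj u v → u ≠ r → G.dist r u ≤ G.dist r v →
      ∃ p, (∀ f ∈ G.incidenceFinset p, G.edgeRank r f < G.edgeRank r s(u, v)) ∧
        #(G.nearEdges s(u, v) \ G.incidenceFinset p) ≤ 35 := by
    intro u v huv hur hle
    obtain ⟨p, hup, hp⟩ := hG.exists_adj_dist_lt hur
    refine ⟨p, fun f hf => ?_, ?_⟩
    · rw [mem_incidenceFinset] at hf
      obtain ⟨hfe, q, rfl⟩ := hf
      have h1 := hG.dist_triangle (u := r) (v := p) (w := q)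
      rw [dist_eq_one_iff_adj.2 (show G.Adj p q from hfe)] at h1
      simp only [edgeRank_mk]
      omega
    · have hpY : p ∈ G.edgeNeighbors u v := by
        rw [edgeNeighbors, mem_union, mem_erase, mem_neighborFinset]
        exact Or.inl ⟨by rintro rfl; omega, hup⟩
      have h1 : #(G.nearEdges s(u, v) \ G.incidenceFinset p) ≤
          #((G.edgeNeighbors u v).erase p) * 5 := by
        refine (card_le_card fun f hf => ?_).trans (card_biUnion_incidenceFinset_le hΔ _)
        rw [mem_sdiff] at hf
        obtain ⟨y, hy, hfy⟩ := nearEdges_subset huv hf.1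
        exact mem_biUnion.2 ⟨y, mem_erase.2 ⟨by rintro rfl; exact hf.2 hfy, hy⟩, hfy⟩
      rw [card_erase_of_mem hpY] at h1
      have h2 := card_edgeNeighbors_le huv
      have := hΔ u
      have := hΔ v
      omega
  induction e with
  | _ u v =>
    rw [Sym2.mem_iff, not_or] at hr
    rcases le_total (G.dist r u) (G.dist r v) with h | h
    · exact main u v he (Ne.symm hr.1) h
    · rw [Sym2.eq_swap]
      exact main v u (Adj.symm he) (Ne.symm hr.2) h

/-! ### The easy cases: a vertex of degree at most four, or a triangle. -/

open Classical in
theorem greedy_near (ρ : Sym2 V → ℕ)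
    (h : ∀ e ∈ G.edgeSet, #{f ∈ G.nearEdges e | ρ e ≤ ρ f} ≤ 36) :
    ∃ c : Sym2 V → Fin 37, ProperOn G.EdgesWithinTwo G.edgeFinset c := by
  obtain ⟨c, hc, -⟩ := ProperOn.greedy_extend (R := G.EdgesWithinTwo) (fun _ _ => .symm)
    (S := ∅) (c := fun _ => (0 : Fin 37)) (by simp [ProperOn]) ρ G.edgeFinset (by simp)
    (fun e he _ => Nat.lt_succ_of_le <| le_trans (card_le_card fun f hf => by
      simp only [mem_filter, notMem_empty, false_or, mem_nearEdges] at hf ⊢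
      tauto) (h e (mem_edgeFinset.1 he)))
  exact ⟨c, hc⟩

/-- An edge at the root has at most 3 + 4 further neighbors at its ends, hence at most 35 conflicts
whatever the order. -/
theorem exists_coloring_of_degree_le_four (hG : G.Connected) (hΔ : ∀ v, G.degree v ≤ 5) (r : V)
    (hr : G.degree r ≤ 4) :
    ∃ c : Sym2 V → Fin 37, ProperOn G.EdgesWithinTwo G.edgeFinset c := by
  classical
  refine greedy_near (G.edgeRank r) fun e he => ?_
  by_cases hre : r ∈ e
  · obtain ⟨v, rfl⟩ := hre
    refine (card_filter_le _ _).trans ((card_nearEdges_le (u := r) (v := v) hΔ he).trans ?_)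
    have := card_edgeNeighbors_le (u := r) (v := v) he
    have := hΔ v
    omega
  · obtain ⟨p, hp, hcard⟩ := exists_closer_vertex hG hΔ he hre
    refine (card_le_card fun f hf => ?_).trans (hcard.trans (by omega))
    rw [mem_filter] at hf
    exact mem_sdiff.2 ⟨hf.1, fun hfp => absurd (hp f hfp) (not_lt.2 hf.2)⟩

theorem exists_coloring_of_triangle (hG : G.Connected) (hΔ : ∀ v, G.degree v ≤ 5) {r b c : V}
    (hrb : G.Adj r b) (hrc : G.Adj r c) (hbc : G.Adj b c) :
    ∃ c : Sym2 V → Fin 37, ProperOn G.EdgesWithinTwo G.edgeFinset c := by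
  classical
  let Δ : Finset (Sym2 V) := {s(r, b), s(r, c), s(b, c)}
  -- Rank 0 puts the triangle last; its edges have at most 35 conflicts, since the third vertex is
  -- counted twice among the neighbors.
  refine greedy_near (fun e => if e ∈ Δ then 0 else G.edgeRank r e) fun e he => ?_
  by_cases heΔ : e ∈ Δ
  · refine (card_filter_le _ _).trans (le_trans ?_ (show 35 ≤ 36 by omega))
    simp only [Δ, mem_insert, mem_singleton] at heΔ
    rcases heΔ with rfl | rfl | rfl
    · exact card_nearEdges_le_of_triangle hΔ hrb hrc hbc
    · exact card_nearEdges_le_of_triangle hΔ hrc hrb hbc.symm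
    · exact card_nearEdges_le_of_triangle hΔ hbc hrb.symm hrc.symm
  by_cases hre : r ∈ e
  · obtain ⟨d, rfl⟩ := hre
    have hd : d ≠ b ∧ d ≠ c := by
      constructor <;> rintro rfl <;> simp [Δ] at heΔ
    have hrd : G.Adj r d := he
    have hb : b ∈ G.edgeNeighbors r d := by
      simp [edgeNeighbors, hrb, hd.1.symm]
    have hc : c ∈ (G.edgeNeighbors r d).erase b := by
      simp [edgeNeighbors, hrc, hd.2.symm, hbc.ne']
    have hinc : ∀ x y z, G.Adj x y → G.Adj x z → y ≠ z →
        #(G.incidenceFinset x \ {s(x, y), s(x, z)}) ≤ 3 := by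
      intro x y z hxy hxz hyz
      rw [card_sdiff_of_subset, card_incidenceFinset_eq_degree, card_pair]
      · have := hΔ x
        omega
      · simpa [hxy.ne'] using hyz
      · intro f hf
        rw [mem_insert, mem_singleton] at hf
        rw [mem_incidenceFinset]
        rcases hf with rfl | rfl
        · exact ⟨hxy, Sym2.mem_mk_left _ _⟩
        · exact ⟨hxz, Sym2.mem_mk_left _ _⟩
    have h1 : G.nearEdges s(r, d) \ Δ ⊆
        (G.incidenceFinset b \ {s(b, r), s(b, c)} ∪ G.incidenceFinset c \ {s(c, r), s(c, b)}) ∪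
        (((G.edgeNeighbors r d).erase b).erase c).biUnion fun y => G.incidenceFinset y := by
      intro f hf
      rw [mem_sdiff] at hf
      have hfΔ := hf.2
      simp only [Δ, mem_insert, mem_singleton, not_or] at hfΔ
      obtain ⟨y, hy, hfy⟩ := nearEdges_subset hrd hf.1
      by_cases hyb : y = b
      · subst hyb
        refine mem_union_left _ (mem_union_left _ (mem_sdiff.2 ⟨hfy, ?_⟩))
        rw [mem_insert, mem_singleton, Sym2.eq_swap]
        tauto
      by_cases hyc : y = c
      · subst hyc
        refine mem_union_left _ (mem_union_right _ (mem_sdiff.2 ⟨hfy, ?_⟩))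
        rw [mem_insert, mem_singleton, Sym2.eq_swap, Sym2.eq_swap (a := y) (b := b)]
        tauto
      · exact mem_union_right _ (mem_biUnion.2
          ⟨y, mem_erase.2 ⟨hyc, mem_erase.2 ⟨hyb, hy⟩⟩, hfy⟩)
    have h2 := card_biUnion_incidenceFinset_le hΔ (((G.edgeNeighbors r d).erase b).erase c)
    rw [card_erase_of_mem hc, card_erase_of_mem hb] at h2
    have h3 := card_edgeNeighbors_le hrd
    have h4 := hΔ r
    have h5 := hΔ d
    have h6 := hinc b r c hrb.symm hbc hrc.ne
    have h7 := hinc c r b hrc.symm hbc.symm hrb.ne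
    have h8 := (card_le_card h1).trans ((card_union_le _ _).trans
      (Nat.add_le_add_right (card_union_le _ _) _))
    -- The bound is exactly 36: three non-triangle edges at each of `b` and `c`, and five at each of
    -- at most six other neighbors.
    refine (card_le_card fun f hf => ?_).trans (h8.trans (by omega))
    rw [mem_filter, if_neg heΔ] at hf
    refine mem_sdiff.2 ⟨hf.1, fun hfΔ => ?_⟩
    rw [if_pos hfΔ, edgeRank_mk, dist_eq_one_iff_adj.2 hrd] at hf
    omega
  · obtain ⟨p, hp, hcard⟩ := exists_closer_vertex hG hΔ he hre
    refine (card_le_card fun f hf => ?_).trans (hcard.trans (by omega))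
    rw [mem_filter, if_neg heΔ] at hf
    refine mem_sdiff.2 ⟨hf.1, fun hfp => absurd (hp f hfp) (not_lt.2 (hf.2.trans ?_))⟩
    split_ifs <;> omega

/-! ### Precoloring near a root of a 5-regular triangle-free graph. -/

/-- The number of walks of length two from `v` to a neighbor of `x`, avoiding `x` in the middle. -/
def rootWeight (G : SimpleGraph V) [DecidableRel G.Adj] (x v : V) : ℕ :=
  ∑ b ∈ (G.neighborFinset v).erase x, #(G.neighborFinset b ∩ G.neighborFinset x)

/-- The colors seen by an edge `xv` when the edges away from `x` are colored. -/
theorem card_image_nearEdges_le (hdeg : ∀ v, G.degree v = 5) {x v : V} (hxv : G.Adj x v)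
    {k : ℕ} (c : Sym2 V → Fin k) (F : Finset (Sym2 V))
    (hF : F ⊆ (G.neighborFinset x).biUnion fun w => (G.incidenceFinset w).erase s(x, w))
    {s : ℕ} (hs : #(F.image c) + s ≤ #F) :
    #((G.nearEdges s(x, v) \ G.incidenceFinset x).image c) + s + G.rootWeight x v ≤ 40 := by
  set E₁ := (G.neighborFinset x).biUnion fun w => (G.incidenceFinset w).erase s(x, w) with hE₁
  -- Edges from `b` to a neighbor of `x` already lie in `E₁`; not counting them twice is what gains
  -- `rootWeight`.
  set E₂ := ((G.neighborFinset v).erase x).biUnion fun b => G.incidenceFinset b \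
    (G.neighborFinset b ∩ G.neighborFinset x).image (fun w => s(b, w)) with hE₂
  have hsub : G.nearEdges s(x, v) \ G.incidenceFinset x ⊆ E₁ ∪ E₂ := by
    intro f hf
    rw [mem_sdiff] at hf
    obtain ⟨y, hy, hfy⟩ := nearEdges_subset hxv hf.1
    have hE : ∀ w ∈ G.neighborFinset x, f ∈ G.incidenceFinset w → f ∈ E₁ := by
      intro w hw hfw
      refine mem_biUnion.2 ⟨w, hw, mem_erase.2 ⟨?_, hfw⟩⟩
      rintro rfl
      refine hf.2 ?_
      rw [mem_incidenceFinset] at hfw ⊢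
      exact ⟨hfw.1, Sym2.mem_mk_left _ _⟩
    rw [edgeNeighbors, mem_union] at hy
    rcases hy with hy | hy
    · exact mem_union_left _ (hE y (mem_of_mem_erase hy) hfy)
    · by_cases hw : ∃ w ∈ G.neighborFinset y ∩ G.neighborFinset x, f = s(y, w)
      · obtain ⟨w, hw, rfl⟩ := hw
        refine mem_union_left _ (hE w (mem_inter.1 hw).2 ?_)
        rw [mem_incidenceFinset] at hfy ⊢
        exact ⟨hfy.1, Sym2.mem_mk_right _ _⟩
      · refine mem_union_right _ (mem_biUnion.2 ⟨y, hy, mem_sdiff.2 ⟨hfy, fun h => hw ?_⟩⟩)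
        obtain ⟨w, hwy, rfl⟩ := mem_image.1 h
        exact ⟨w, hwy, rfl⟩
  have hcard : ∀ w, #(G.incidenceFinset w) = 5 := fun w => by
    rw [card_incidenceFinset_eq_degree, hdeg]
  have hN : ∀ w, #(G.neighborFinset w) = 5 := fun w => by
    rw [card_neighborFinset_eq_degree, hdeg]
  have h1 : #E₁ ≤ 20 := by
    refine (card_biUnion_le_card_mul _ _ 4 fun w hw => ?_).trans (by rw [hN])
    rw [card_erase_of_mem, hcard]
    rw [mem_incidenceFinset]
    exact ⟨by simpa using hw, Sym2.mem_mk_right _ _⟩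
  have h2 : #E₂ + G.rootWeight x v ≤ 20 := by
    have h3 : #E₂ ≤ _ := card_biUnion_le
    refine (Nat.add_le_add_right h3 _).trans ?_
    rw [rootWeight, ← sum_add_distrib]
    refine (sum_le_card_nsmul _ _ 5 fun b _ => ?_).trans ?_
    · rw [card_sdiff_of_subset, hcard, card_image_of_injective]
      · have := card_le_card (inter_subset_left :
          G.neighborFinset b ∩ G.neighborFinset x ⊆ G.neighborFinset b)
        rw [hN] at this
        omega
      · intro p q hpq
        exact Sym2.congr_right.1 hpq
      · intro f hf
        obtain ⟨w, hw, rfl⟩ := mem_image.1 hf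
        rw [mem_incidenceFinset]
        exact ⟨by simpa using (mem_inter.1 hw).1, Sym2.mem_mk_left _ _⟩
    · rw [card_erase_of_mem (by simpa using hxv.symm), hN]
      simp
  have h4 : #(E₁.image c) + s ≤ 20 := by
    have h5 : E₁.image c ⊆ F.image c ∪ (E₁ \ F).image c := by
      rw [← image_union, union_sdiff_of_subset hF]
    have h6 := (card_le_card h5).trans (card_union_le _ _)
    have h7 := card_image_le (s := E₁ \ F) (f := c)
    have h8 := card_le_card hF
    rw [card_sdiff_of_subset hF] at h7
    omega
  have h9 := (card_le_card (image_subset_image (f := c) hsub)).trans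
    ((congrArg card (image_union _ _)).le.trans (card_union_le _ _))
  have h10 := card_image_le (s := E₂) (f := c)
  omega

/-- The palette at `xv` has at least `rootWeight x v + s - 3` colors, so `hD` is Hall's condition:
at most `j` palettes have size at most `j`. In `hcol` only adjacencies involving some `a i` matter,
as the `w i` are pairwise nonadjacent without triangles. -/
theorem exists_coloring_of_root (hG : G.Connected) (hdeg : ∀ v, G.degree v = 5)
    (hT : ∀ a b c, G.Adj a b → G.Adj a c → ¬ G.Adj b c) (x : V) {m : ℕ} (s : ℕ)
    (w a : Fin m → V) (col : Fin m → Fin 37) (hxw : ∀ i, G.Adj x (w i))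
    (hwa : ∀ i, G.Adj (w i) (a i)) (hax : ∀ i, a i ≠ x) (hw : Function.Injective w)
    (ha : Function.Injective a)
    (hcol : ∀ i j, i ≠ j → col i = col j → ¬ G.Adj (a i) (w j) ∧ ¬ G.Adj (a i) (a j))
    (hs : #(univ.image col) + s ≤ m)
    (hD : ∀ j ≤ 4, #{v ∈ G.neighborFinset x | G.rootWeight x v + s < j + 4} ≤ j) :
    ∃ c : Sym2 V → Fin 37, ProperOn G.EdgesWithinTwo G.edgeFinset c := by
  classical
  have haw : ∀ i j, a i ≠ w j := fun i j h =>
    hT x (w i) (w j) (hxw i) (hxw j) (h ▸ hwa i)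
  have hinj : Function.Injective fun i => s(w i, a i) := by
    intro i j hij
    rcases Sym2.eq_iff.1 hij with h | h
    · exact hw h.1
    · exact absurd h.2 (haw i j)
  have hdisj : ∀ i j p, p ∈ s(w i, a i) → p ∈ s(w j, a j) → i = j := by
    intro i j p hi hj
    rcases Sym2.mem_iff.1 hi with rfl | rfl <;> rcases Sym2.mem_iff.1 hj with h | h
    · exact hw h
    · exact absurd h.symm (haw j i)
    · exact absurd h (haw i j)
    · exact ha h
  set F : Finset (Sym2 V) := univ.image fun i => s(w i, a i) with hF
  set c₀ : Sym2 V → Fin 37 := Function.extend (fun i => s(w i, a i)) col fun _ => 0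
  have hc₀ : ∀ i, c₀ s(w i, a i) = col i := fun i => hinj.extend_apply _ _ i
  have hproper : ProperOn G.EdgesWithinTwo F c₀ := by
    intro e he f hf hef hnear
    obtain ⟨i, -, rfl⟩ := mem_image.1 he
    obtain ⟨j, -, rfl⟩ := mem_image.1 hf
    have hij : i ≠ j := by rintro rfl; exact hef rfl
    rw [hc₀, hc₀]
    intro hc
    obtain ⟨p, hp, q, hq, hpq⟩ := hnear
    rcases hpq with rfl | hpq
    · exact hij (hdisj _ _ _ hp hq)
    rcases Sym2.mem_iff.1 hp with rfl | rfl <;> rcases Sym2.mem_iff.1 hq with rfl | rfl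
    · exact hT x _ _ (hxw i) (hxw j) hpq
    · exact (hcol j i hij.symm hc.symm).1 hpq.symm
    · exact (hcol i j hij hc).1 hpq
    · exact (hcol i j hij hc).2 hpq
  set T := G.edgeFinset \ G.incidenceFinset x with hTdef
  have memT : ∀ e, e ∈ T ↔ e ∈ G.edgeSet ∧ x ∉ e := by
    intro e
    rw [hTdef, mem_sdiff, mem_edgeFinset, mem_incidenceFinset]
    constructor
    · exact fun h => ⟨h.1, fun hx => h.2 ⟨h.1, hx⟩⟩
    · exact fun h => ⟨h.1, fun hx => h.2 hx.2⟩
  have hFT : F ⊆ T := by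
    intro e he
    obtain ⟨i, -, rfl⟩ := mem_image.1 he
    rw [memT, Sym2.mem_iff, not_or]
    exact ⟨hwa i, (hxw i).ne, (hax i).symm⟩
  obtain ⟨c, hc, hcF⟩ := hproper.greedy_extend (fun _ _ => .symm) (G.edgeRank x) T hFT
    (by
      intro e he heF
      rw [memT] at he
      obtain ⟨p, hp, hcard⟩ := exists_closer_vertex hG (fun v => (hdeg v).le) he.1 he.2
      -- The precolored edges form a matching, so they add at most one to the 35 greedy conflicts:
      -- still below 37.
      have h1 : #(F ∩ G.incidenceFinset p) ≤ 1 := by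
        refine card_le_one.2 fun f hf g hg => ?_
        rw [mem_inter, mem_incidenceFinset] at hf hg
        obtain ⟨⟨hf, -, hpf⟩, ⟨hg, -, hpg⟩⟩ := hf, hg
        obtain ⟨i, -, rfl⟩ := mem_image.1 hf
        obtain ⟨j, -, rfl⟩ := mem_image.1 hg
        rw [hdisj i j p hpf hpg]
      refine lt_of_le_of_lt (card_le_card (t := (G.nearEdges e \ G.incidenceFinset p) ∪
        (F ∩ G.incidenceFinset p)) fun f hf => ?_)
        (lt_of_le_of_lt (card_union_le _ _) (by omega))
      rw [mem_filter, memT] at hf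
      have hfe : f ∈ G.nearEdges e :=
        mem_nearEdges.2 ⟨mem_edgeFinset.2 hf.1.1, hf.2.1, hf.2.2.1⟩
      by_cases hfp : f ∈ G.incidenceFinset p
      · rcases hf.2.2.2 with h | h
        · exact mem_union_right _ (mem_inter.2 ⟨h, hfp⟩)
        · exact absurd (hp f hfp) (not_lt.2 h)
      · exact mem_union_left _ (mem_sdiff.2 ⟨hfe, hfp⟩))
  have hFcard : #F = m := by
    rw [hF, card_image_of_injective _ hinj, card_univ, Fintype.card_fin]
  have hFc : F.image c = univ.image col := by
    rw [hF, image_image]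
    refine image_congr fun i _ => ?_
    rw [Function.comp_apply, hcF _ (mem_image_of_mem _ (mem_univ i)), hc₀]
  have hFE : F ⊆ (G.neighborFinset x).biUnion fun w => (G.incidenceFinset w).erase s(x, w) := by
    intro e he
    have heT := (memT e).1 (hFT he)
    obtain ⟨i, -, rfl⟩ := mem_image.1 he
    refine mem_biUnion.2 ⟨w i, by simpa using hxw i, mem_erase.2 ⟨?_, ?_⟩⟩
    · intro h
      exact heT.2 (h ▸ Sym2.mem_mk_left _ _)
    · rw [mem_incidenceFinset]
      exact ⟨heT.1, Sym2.mem_mk_left _ _⟩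
  -- Edges at `x` conflict pairwise, so they need distinct colors from these palettes.
  let L : {v // v ∈ G.neighborFinset x} → Finset (Fin 37) := fun v =>
    ((G.nearEdges s(x, v) \ G.incidenceFinset x).image c)ᶜ
  have hL : ∀ v : {v // v ∈ G.neighborFinset x}, G.rootWeight x v + s ≤ #(L v) + 3 := by
    intro v
    have := card_image_nearEdges_le hdeg ((G.mem_neighborFinset _ _).1 v.2) c F hFE
      (by rwa [hFc, hFcard])
    rw [card_compl, Fintype.card_fin]
    omega
  obtain ⟨g, hg, hgL⟩ := exists_injective_of_card_filter_lt L (by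
    intro n hn hn5
    rw [Fintype.card_coe, card_neighborFinset_eq_degree, hdeg] at hn5
    refine lt_of_le_of_lt ?_ (Nat.sub_lt hn one_pos)
    refine le_trans ?_ (hD (n - 1) (by omega))
    refine card_le_card_of_injOn Subtype.val ?_ (Subtype.val_injective.injOn)
    intro v hv
    have hv' : #(L v) < n := by simpa using hv
    have := hL v
    rw [mem_coe, mem_filter]
    exact ⟨v.2, by omega⟩)
  have hxinj : Function.Injective fun v : {v // v ∈ G.neighborFinset x} => s(x, (v : V)) := by
    intro p q hpq
    exact Subtype.ext (Sym2.congr_right.1 hpq)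
  set c' : Sym2 V → Fin 37 :=
    Function.extend (fun v : {v // v ∈ G.neighborFinset x} => s(x, (v : V))) g c
  have hc'1 : ∀ v : {v // v ∈ G.neighborFinset x}, c' s(x, (v : V)) = g v :=
    fun v => hxinj.extend_apply _ _ v
  have hc'2 : ∀ e, x ∉ e → c' e = c e := fun e he =>
    Function.extend_apply' _ _ _ (by rintro ⟨v, rfl⟩; exact he (Sym2.mem_mk_left _ _))
  have hcross : ∀ v : {v // v ∈ G.neighborFinset x}, ∀ f ∈ G.edgeSet, x ∉ f →
      G.EdgesWithinTwo s(x, (v : V)) f → g v ≠ c f := by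
    intro v f hf hxf hnear h
    refine mem_compl.1 (hgL v) (h ▸ mem_image_of_mem _ (mem_sdiff.2 ⟨mem_nearEdges.2
      ⟨mem_edgeFinset.2 hf, ?_, hnear⟩, fun hx => hxf ?_⟩))
    · rintro rfl
      exact hxf (Sym2.mem_mk_left _ _)
    · exact ((G.mem_incidenceFinset _ _).1 hx).2
  have hroot : ∀ e ∈ G.edgeSet, x ∈ e →
      ∃ v : {v // v ∈ G.neighborFinset x}, e = s(x, (v : V)) := by
    rintro e he ⟨v, rfl⟩
    exact ⟨⟨v, (G.mem_neighborFinset _ _).2 he⟩, rfl⟩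
  refine ⟨c', fun e he f hf hef hnear => ?_⟩
  rw [mem_edgeFinset] at he hf
  by_cases hxe : x ∈ e <;> by_cases hxf : x ∈ f
  · obtain ⟨v, rfl⟩ := hroot e he hxe
    obtain ⟨u, rfl⟩ := hroot f hf hxf
    rw [hc'1, hc'1]
    exact fun h => hef (by rw [hg h])
  · obtain ⟨v, rfl⟩ := hroot e he hxe
    rw [hc'1, hc'2 f hxf]
    exact hcross v f hf hxf hnear
  · obtain ⟨u, rfl⟩ := hroot f hf hxf
    rw [hc'1, hc'2 e hxe]
    exact (hcross u e he hxe hnear.symm).symm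
  · rw [hc'2 e hxe, hc'2 f hxf]
    exact hc e ((memT e).2 ⟨he, hxe⟩) f ((memT f).2 ⟨hf, hxf⟩) hef hnear

/-! ### Lower bounds for root weights. -/

theorem one_le_card_inter_neighborFinset {x v b : V} (hxv : G.Adj x v)
    (hb : b ∈ (G.neighborFinset v).erase x) :
    1 ≤ #(G.neighborFinset b ∩ G.neighborFinset x) :=
  card_pos.2 ⟨v, by simp_all [G.adj_comm]⟩

theorem four_le_rootWeight (hdeg : ∀ v, G.degree v = 5) {x v : V} (hxv : G.Adj x v) :
    4 ≤ G.rootWeight x v := by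
  have := card_nsmul_le_sum ((G.neighborFinset v).erase x)
    (fun b => #(G.neighborFinset b ∩ G.neighborFinset x)) 1
    fun b hb => one_le_card_inter_neighborFinset hxv hb
  rw [card_erase_of_mem (by simpa using hxv.symm), card_neighborFinset_eq_degree, hdeg] at this
  simpa [rootWeight] using this

theorem card_add_three_le_rootWeight (hdeg : ∀ v, G.degree v = 5) {x v y : V} (hxv : G.Adj x v)
    (hvy : G.Adj v y) (hyx : y ≠ x) :
    #(G.neighborFinset y ∩ G.neighborFinset x) + 3 ≤ G.rootWeight x v := by
  have hy : y ∈ (G.neighborFinset v).erase x := by simp [hyx, hvy]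
  have := card_nsmul_le_sum (((G.neighborFinset v).erase x).erase y)
    (fun b => #(G.neighborFinset b ∩ G.neighborFinset x)) 1
    fun b hb => one_le_card_inter_neighborFinset hxv (mem_of_mem_erase hb)
  rw [card_erase_of_mem hy, card_erase_of_mem (by simpa using hxv.symm),
    card_neighborFinset_eq_degree, hdeg] at this
  rw [rootWeight, ← add_sum_erase _ _ hy]
  simpa using this

theorem card_add_card_add_two_le_rootWeight (hdeg : ∀ v, G.degree v = 5) {x v y y' : V}
    (hxv : G.Adj x v) (hvy : G.Adj v y) (hyx : y ≠ x) (hvy' : G.Adj v y') (hyx' : y' ≠ x)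
    (hyy' : y ≠ y') :
    #(G.neighborFinset y ∩ G.neighborFinset x) + #(G.neighborFinset y' ∩ G.neighborFinset x) + 2 ≤
      G.rootWeight x v := by
  have hy : y ∈ (G.neighborFinset v).erase x := by simp [hyx, hvy]
  have hy' : y' ∈ ((G.neighborFinset v).erase x).erase y := by simp [hyx', hvy', hyy'.symm]
  have := card_nsmul_le_sum ((((G.neighborFinset v).erase x).erase y).erase y')
    (fun b => #(G.neighborFinset b ∩ G.neighborFinset x)) 1
    fun b hb => one_le_card_inter_neighborFinset hxv (mem_of_mem_erase (mem_of_mem_erase hb))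
  rw [card_erase_of_mem hy', card_erase_of_mem hy, card_erase_of_mem (by simpa using hxv.symm),
    card_neighborFinset_eq_degree, hdeg] at this
  rw [rootWeight, ← add_sum_erase _ _ hy, ← add_sum_erase _ _ hy', add_assoc]
  simpa using this

theorem two_le_card_inter_neighborFinset {x u v a : V} (hu : G.Adj x u) (hv : G.Adj x v)
    (huv : u ≠ v) (hua : G.Adj u a) (hva : G.Adj v a) :
    2 ≤ #(G.neighborFinset a ∩ G.neighborFinset x) := by
  rw [← card_pair huv]
  refine card_le_card fun b hb => ?_
  rw [mem_insert, mem_singleton] at hb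
  rcases hb with rfl | rfl <;> simp [*, G.adj_comm a]

/-- Hall's condition in complementary form: it is enough to exhibit, for each `j`, at least `5 - j`
neighbors of large weight. -/
theorem card_filter_rootWeight_le (hdeg : ∀ v, G.degree v = 5) {x : V} {s : ℕ}
    (h : ∀ j ≤ 4, ∃ Z ⊆ G.neighborFinset x, 5 ≤ #Z + j ∧ ∀ v ∈ Z, j + 4 ≤ G.rootWeight x v + s) :
    ∀ j ≤ 4, #{v ∈ G.neighborFinset x | G.rootWeight x v + s < j + 4} ≤ j := by
  intro j hj
  obtain ⟨Z, hZ, hcard, hw⟩ := h j hj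
  have h1 : {v ∈ G.neighborFinset x | G.rootWeight x v + s < j + 4} ⊆ G.neighborFinset x \ Z := by
    intro v hv
    rw [mem_filter] at hv
    exact mem_sdiff.2 ⟨hv.1, fun h => absurd (hw v h) (not_le.2 hv.2)⟩
  have h2 := card_le_card h1
  rw [card_sdiff_of_subset hZ, card_neighborFinset_eq_degree, hdeg] at h2
  omega

/-! ### Maximum codegree five, four or three. -/

/-- The edges `wa` and `w'a'`, where `w` and `w'` have a common neighbor, are at distance more
than two in a triangle-free graph. -/
structure FarPair (G : SimpleGraph V) (w a w' a' : V) : Prop where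
  ne : w ≠ w'
  ne' : a ≠ a'
  right : ¬ G.Adj a w'
  left : ¬ G.Adj a' w
  far : ¬ G.Adj a a'

theorem exists_coloring_of_farPair (hG : G.Connected) (hdeg : ∀ v, G.degree v = 5)
    (hT : ∀ a b c, G.Adj a b → G.Adj a c → ¬ G.Adj b c) {x w a w' a' : V}
    (hxw : G.Adj x w) (hxw' : G.Adj x w') (hwa : G.Adj w a) (hwa' : G.Adj w' a')
    (hax : a ≠ x) (hax' : a' ≠ x) (h : G.FarPair w a w' a')
    (hD : ∀ j ≤ 4, ∃ Z ⊆ G.neighborFinset x, 5 ≤ #Z + j ∧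
      ∀ v ∈ Z, j + 4 ≤ G.rootWeight x v + 1) :
    ∃ c : Sym2 V → Fin 37, ProperOn G.EdgesWithinTwo G.edgeFinset c := by
  obtain ⟨h1, h2, h3, h4, h5⟩ := h
  refine exists_coloring_of_root hG hdeg hT x 1 ![w, w'] ![a, a'] ![0, 0] ?_ ?_ ?_ ?_ ?_ ?_
    (by decide) (card_filter_rootWeight_le hdeg hD)
  all_goals simp [Fin.forall_fin_succ, Function.Injective, h1.symm, h2.symm, *,
    G.adj_comm a' a]

theorem exists_coloring_of_two_farPairs (hG : G.Connected) (hdeg : ∀ v, G.degree v = 5)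
    (hT : ∀ a b c, G.Adj a b → G.Adj a c → ¬ G.Adj b c) {x : V} {w a : Fin 4 → V}
    (hxw : ∀ i, G.Adj x (w i)) (hwa : ∀ i, G.Adj (w i) (a i))
    (hax : ∀ i, a i ≠ x) (hw : Function.Injective w) (ha : Function.Injective a)
    (h : G.FarPair (w 0) (a 0) (w 1) (a 1)) (h' : G.FarPair (w 2) (a 2) (w 3) (a 3))
    (hD : ∀ j ≤ 4, ∃ Z ⊆ G.neighborFinset x, 5 ≤ #Z + j ∧
      ∀ v ∈ Z, j + 4 ≤ G.rootWeight x v + 2) :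
    ∃ c : Sym2 V → Fin 37, ProperOn G.EdgesWithinTwo G.edgeFinset c := by
  obtain ⟨-, -, h3, h4, h5⟩ := h
  obtain ⟨-, -, h3', h4', h5'⟩ := h'
  refine exists_coloring_of_root hG hdeg hT x 2 w a ![0, 0, 1, 1] hxw hwa hax hw ha ?_
    (by decide) (card_filter_rootWeight_le hdeg hD)
  simp [Fin.forall_fin_succ, *, G.adj_comm (a 1) (a 0), G.adj_comm (a 3) (a 2)]

/-- Every neighbor of `x` has weight at least 5 + 3, so all palettes have five colors without any
precoloring. -/
theorem exists_coloring_of_card_inter_eq_five (hG : G.Connected) (hdeg : ∀ v, G.degree v = 5)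
    (hT : ∀ a b c, G.Adj a b → G.Adj a c → ¬ G.Adj b c) {x y : V} (hxy : x ≠ y)
    (h : 5 ≤ #(G.neighborFinset x ∩ G.neighborFinset y)) :
    ∃ c : Sym2 V → Fin 37, ProperOn G.EdgesWithinTwo G.edgeFinset c := by
  refine exists_coloring_of_root hG hdeg hT x (m := 0) 0 Fin.elim0 Fin.elim0 Fin.elim0
    (fun i => i.elim0) (fun i => i.elim0) (fun i => i.elim0) (fun i => i.elim0) (fun i => i.elim0)
    (fun i => i.elim0) (by simp) (card_filter_rootWeight_le hdeg fun j hj =>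
      ⟨_, inter_subset_left, h.trans (Nat.le_add_right _ _), fun v hv => ?_⟩)
  rw [mem_inter, mem_neighborFinset, mem_neighborFinset] at hv
  have := card_add_three_le_rootWeight hdeg hv.1 hv.2.symm hxy.symm
  rw [inter_comm] at this
  omega

/-- Without triangles, common neighbors of `w` and `y` avoid those of `x` and `y`, so there are at
most two, against four neighbors of `w` besides `x`. -/
theorem exists_mem_notMem_neighborFinset (hdeg : ∀ v, G.degree v = 5)
    (hT : ∀ a b c, G.Adj a b → G.Adj a c → ¬ G.Adj b c) {x y w : V}
    (h3 : 3 ≤ #(G.neighborFinset x ∩ G.neighborFinset y)) (hxw : G.Adj x w) :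
    ∃ b, G.Adj w b ∧ b ≠ x ∧ ¬ G.Adj y b := by
  have h1 : G.neighborFinset w ∩ G.neighborFinset y ⊆
      G.neighborFinset y \ (G.neighborFinset x ∩ G.neighborFinset y) := by
    intro b hb
    simp only [mem_inter, mem_sdiff, mem_neighborFinset, not_and] at hb ⊢
    exact ⟨hb.2, fun h => absurd hb.1 (hT x w b hxw h)⟩
  have h2 := card_le_card h1
  rw [card_sdiff_of_subset inter_subset_right, card_neighborFinset_eq_degree, hdeg] at h2
  have h4 : #(G.neighborFinset w ∩ G.neighborFinset y) < #((G.neighborFinset w).erase x) := by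
    rw [card_erase_of_mem (by simpa using hxw.symm), card_neighborFinset_eq_degree, hdeg]
    omega
  obtain ⟨b, hb, hb'⟩ := exists_mem_notMem_of_card_lt_card h4
  simp only [mem_erase, mem_neighborFinset, mem_inter, not_and] at hb hb'
  exact ⟨b, hb.2, hb.1, hb' hb.2⟩

theorem exists_coloring_of_farPair_of_le (hG : G.Connected) (hdeg : ∀ v, G.degree v = 5)
    (hT : ∀ a b c, G.Adj a b → G.Adj a c → ¬ G.Adj b c) {x y : V} (hxy : x ≠ y)
    (hk : ∀ u, u ≠ x →
      #(G.neighborFinset u ∩ G.neighborFinset x) ≤ #(G.neighborFinset x ∩ G.neighborFinset y))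
    (h3 : 3 ≤ #(G.neighborFinset x ∩ G.neighborFinset y))
    (h4 : #(G.neighborFinset x ∩ G.neighborFinset y) ≤ 4)
    (hD : ∀ j ≤ 4, ∃ Z ⊆ G.neighborFinset x, 5 ≤ #Z + j ∧
      ∀ v ∈ Z, j + 4 ≤ G.rootWeight x v + 1) :
    ∃ c : Sym2 V → Fin 37, ProperOn G.EdgesWithinTwo G.edgeFinset c := by
  obtain ⟨w, hw, hwy⟩ := exists_mem_notMem_of_card_lt_card
    (s := G.neighborFinset x ∩ G.neighborFinset y) (t := G.neighborFinset x)
    (by rw [card_neighborFinset_eq_degree, hdeg]; omega)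
  simp only [mem_inter, mem_neighborFinset, not_and] at hw hwy
  replace hwy := hwy hw
  obtain ⟨b, hwb, hbx, hyb⟩ := exists_mem_notMem_neighborFinset hdeg hT h3 hw
  -- Otherwise `w` together with all these vertices would give `b` and `x` a codegree above the
  -- maximum.
  obtain ⟨z, hz, hbz⟩ : ∃ z ∈ G.neighborFinset x ∩ G.neighborFinset y, ¬ G.Adj b z := by
    by_contra! hall
    have h1 : insert w (G.neighborFinset x ∩ G.neighborFinset y) ⊆
        G.neighborFinset b ∩ G.neighborFinset x := by
      intro z hz
      rw [mem_insert] at hz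
      rcases hz with rfl | hz
      · simp [hw, hwb.symm]
      · have := hall z hz
        simp_all
    have h2 := card_le_card h1
    rw [card_insert_of_notMem (by simp [hwy])] at h2
    have := hk b hbx
    omega
  rw [mem_inter, mem_neighborFinset, mem_neighborFinset] at hz
  refine exists_coloring_of_farPair hG hdeg hT hz.1 hw hz.2.symm hwb hxy.symm hbx
    ⟨?_, ?_, hwy, hbz, hyb⟩ hD
  · rintro rfl
    exact hwy hz.2
  · rintro rfl
    exact hwy hwb.symm

/-- With one color saved, the palettes have sizes at least 2, 5, 5, 5, 5. -/
theorem exists_coloring_of_card_inter_eq_four (hG : G.Connected) (hdeg : ∀ v, G.degree v = 5)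
    (hT : ∀ a b c, G.Adj a b → G.Adj a c → ¬ G.Adj b c) {x y : V} (hxy : x ≠ y)
    (hk : ∀ u, u ≠ x → #(G.neighborFinset u ∩ G.neighborFinset x) ≤ 4)
    (h4 : #(G.neighborFinset x ∩ G.neighborFinset y) = 4) :
    ∃ c : Sym2 V → Fin 37, ProperOn G.EdgesWithinTwo G.edgeFinset c := by
  refine exists_coloring_of_farPair_of_le hG hdeg hT hxy (by rwa [h4]) (by omega) h4.le
    fun j hj => ?_
  rcases Nat.lt_or_ge j 2 with hj2 | hj2
  · refine ⟨_, subset_rfl, ?_, fun v hv => ?_⟩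
    · rw [card_neighborFinset_eq_degree, hdeg]
      omega
    · have := four_le_rootWeight hdeg ((G.mem_neighborFinset _ _).1 hv)
      omega
  · refine ⟨_, inter_subset_left (s₂ := G.neighborFinset y), by omega, fun v hv => ?_⟩
    rw [mem_inter, mem_neighborFinset, mem_neighborFinset] at hv
    have := card_add_three_le_rootWeight hdeg hv.1 hv.2.symm hxy.symm
    rw [inter_comm] at this
    omega

/-- If some neighbor of `x` has weight 7, one far pair is enough. Otherwise the weights are so tight
that a second, disjoint pair exists, and the palettes have sizes at least 3, 3, 5, 5, 5. -/
theorem exists_coloring_of_card_inter_eq_three (hG : G.Connected) (hdeg : ∀ v, G.degree v = 5)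
    (hT : ∀ a b c, G.Adj a b → G.Adj a c → ¬ G.Adj b c) {x y : V} (hxy : x ≠ y)
    (hk : ∀ u v, u ≠ v → #(G.neighborFinset u ∩ G.neighborFinset v) ≤ 3)
    (h3 : #(G.neighborFinset x ∩ G.neighborFinset y) = 3) :
    ∃ c : Sym2 V → Fin 37, ProperOn G.EdgesWithinTwo G.edgeFinset c := by
  have hZ : ∀ v ∈ G.neighborFinset x ∩ G.neighborFinset y, 6 ≤ G.rootWeight x v := by
    intro v hv
    rw [mem_inter, mem_neighborFinset, mem_neighborFinset] at hv
    have := card_add_three_le_rootWeight hdeg hv.1 hv.2.symm hxy.symm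
    rw [inter_comm] at this
    omega
  by_cases h7 : ∃ z ∈ G.neighborFinset x, 7 ≤ G.rootWeight x z
  · obtain ⟨z, hz, hz7⟩ := h7
    refine exists_coloring_of_farPair_of_le hG hdeg hT hxy (fun u hu => by rw [h3]; exact hk _ _ hu)
      h3.ge (by omega) fun j hj => ?_
    rcases Nat.lt_or_ge j 2 with hj2 | hj2
    · refine ⟨_, subset_rfl, ?_, fun v hv => ?_⟩
      · rw [card_neighborFinset_eq_degree, hdeg]
        omega
      · have := four_le_rootWeight hdeg ((G.mem_neighborFinset _ _).1 hv)
        omega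
    rcases Nat.lt_or_ge j 4 with hj4 | hj4
    · refine ⟨_, inter_subset_left (s₂ := G.neighborFinset y), by omega, fun v hv => ?_⟩
      have := hZ v hv
      omega
    · refine ⟨{z}, by simpa using hz, by rw [card_singleton]; omega, fun v hv => ?_⟩
      rw [mem_singleton] at hv
      subst hv
      omega
  push Not at h7
  -- In the weight of `z`, at most 6, `y` contributes 3 and two other vertices at least 1 each,
  -- leaving 1 for `p`, which `z` itself uses up.
  have huniq : ∀ z, G.Adj x z → G.Adj y z → ∀ p, G.Adj z p → p ≠ x → p ≠ y →
      ∀ w, G.Adj x w → w ≠ z → ¬ G.Adj w p := by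
    intro z hxz hyz p hzp hpx hpy w hxw hwz hwp
    have h1 := card_add_card_add_two_le_rootWeight hdeg hxz hyz.symm hxy.symm hzp hpx hpy.symm
    have h2 := two_le_card_inter_neighborFinset hxw hxz hwz hwp hzp
    have h4 := h7 z (by simpa using hxz)
    rw [inter_comm] at h1
    omega
  obtain ⟨z₁, hz₁, z₂, hz₂, hz⟩ := one_lt_card.1
    (show 1 < #(G.neighborFinset x ∩ G.neighborFinset y) by omega)
  obtain ⟨w₁, hw₁, w₂, hw₂, hw⟩ := one_lt_card.1
    (show 1 < #(G.neighborFinset x \ (G.neighborFinset x ∩ G.neighborFinset y)) by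
      rw [card_sdiff_of_subset inter_subset_left, card_neighborFinset_eq_degree, hdeg]; omega)
  simp only [mem_inter, mem_sdiff, mem_neighborFinset, not_and] at hz₁ hz₂ hw₁ hw₂
  obtain ⟨hxw₁, hyw₁⟩ := hw₁
  obtain ⟨hxw₂, hyw₂⟩ := hw₂
  replace hyw₁ := hyw₁ hxw₁
  replace hyw₂ := hyw₂ hxw₂
  have hzw : ∀ z w, G.Adj y z → ¬ G.Adj y w → w ≠ z := by
    rintro z w h1 h2 rfl
    exact h2 h1
  obtain ⟨b, hwb, hbx, hyb⟩ := exists_mem_notMem_neighborFinset hdeg hT h3.ge hxw₁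
  have hby : b ≠ y := by
    rintro rfl
    exact hyw₁ hwb.symm
  have hbz : ¬ G.Adj b z₁ := fun h =>
    huniq z₁ hz₁.1 hz₁.2 b h.symm hbx hby w₁ hxw₁ (hzw _ _ hz₁.2 hyw₁) hwb
  -- Otherwise two choices of `p` would share `z₂` and three neighbors of `w₂`, contradicting
  -- codegree at most 3.
  obtain ⟨p, hzp, hpx, hpy, b', hwb', hbx', hbb', hpb⟩ : ∃ p, G.Adj z₂ p ∧ p ≠ x ∧ p ≠ y ∧
      ∃ b', G.Adj w₂ b' ∧ b' ≠ x ∧ b' ≠ b ∧ ¬ G.Adj p b' := by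
    by_contra! hall
    obtain ⟨p, hp, p', hp', hpp⟩ := one_lt_card.1
      (show 1 < #(((G.neighborFinset z₂).erase x).erase y) by
        rw [card_erase_of_mem (by simp [hxy.symm, hz₂.2.symm]),
          card_erase_of_mem (by simp [hz₂.1.symm]), card_neighborFinset_eq_degree, hdeg]
        omega)
    simp only [mem_erase, mem_neighborFinset] at hp hp'
    have h1 : insert z₂ (((G.neighborFinset w₂).erase x).erase b) ⊆
        G.neighborFinset p ∩ G.neighborFinset p' := by
      intro q hq
      rw [mem_insert, mem_erase, mem_erase, mem_neighborFinset] at hq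
      rw [mem_inter, mem_neighborFinset, mem_neighborFinset]
      rcases hq with rfl | hq
      · exact ⟨hp.2.2.symm, hp'.2.2.symm⟩
      · exact ⟨hall p hp.2.2 hp.2.1 hp.1 q hq.2.2 hq.2.1 hq.1,
          hall p' hp'.2.2 hp'.2.1 hp'.1 q hq.2.2 hq.2.1 hq.1⟩
    have h2 := card_le_card h1
    rw [card_insert_of_notMem (by simp [hT x w₂ z₂ hxw₂ hz₂.1])] at h2
    have h4 := pred_card_le_card_erase (s := (G.neighborFinset w₂).erase x) (a := b)
    rw [card_erase_of_mem (by simp [hxw₂.symm]), card_neighborFinset_eq_degree, hdeg] at h4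
    have := hk p p' hpp
    omega
  have hby' : b' ≠ y := by
    rintro rfl
    exact hyw₂ hwb'.symm
  have hpw : ∀ w, G.Adj x w → ¬ G.Adj y w → ¬ G.Adj w p := fun w hxw hyw =>
    huniq z₂ hz₂.1 hz₂.2 p hzp hpx hpy w hxw (hzw _ _ hz₂.2 hyw)
  have hpb' : p ≠ b' := by
    rintro rfl
    exact hpw w₂ hxw₂ hyw₂ hwb'
  have hpb₁ : p ≠ b := by
    rintro rfl
    exact hpw w₁ hxw₁ hyw₁ hwb
  have n₁ := hzw _ _ hz₁.2 hyw₁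
  have n₂ := hzw _ _ hz₁.2 hyw₂
  have n₃ := hzw _ _ hz₂.2 hyw₁
  have n₄ := hzw _ _ hz₂.2 hyw₂
  refine exists_coloring_of_two_farPairs hG hdeg hT (x := x) (w := ![z₁, w₁, z₂, w₂])
    (a := ![y, b, p, b']) ?_ ?_ ?_ ?_ ?_ ⟨n₁.symm, hby.symm, hyw₁, hbz, hyb⟩
    ⟨n₄.symm, hpb', fun h => hpw w₂ hxw₂ hyw₂ h.symm, fun h =>
      huniq z₂ hz₂.1 hz₂.2 b' h.symm hbx' hby' w₂ hxw₂ n₄ hwb', hpb⟩ fun j hj => ?_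
  · simp [Fin.forall_fin_succ, *]
  · simp [Fin.forall_fin_succ, hz₁.2.symm, *]
  · simp [Fin.forall_fin_succ, hxy.symm, *]
  · simp [Fin.forall_fin_succ, Function.Injective, hz, hz.symm, hw, hw.symm, n₁, n₂, n₃, n₄,
      n₁.symm, n₂.symm, n₃.symm, n₄.symm]
  · simp [Fin.forall_fin_succ, Function.Injective, hby, hby.symm, hpy, hpy.symm, hby', hby'.symm,
      hpb₁, hpb₁.symm, hbb', hbb'.symm, hpb', hpb'.symm]
  rcases Nat.lt_or_ge j 3 with hj3 | hj3
  · refine ⟨_, subset_rfl, ?_, fun v hv => ?_⟩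
    · rw [card_neighborFinset_eq_degree, hdeg]
      omega
    · have := four_le_rootWeight hdeg ((G.mem_neighborFinset _ _).1 hv)
      omega
  · refine ⟨_, inter_subset_left (s₂ := G.neighborFinset y), by omega, fun v hv => ?_⟩
    have := hZ v hv
    omega

/-! ### Maximum codegree two. -/

omit [DecidableEq V] in
theorem exists_equiv_neighborFinset (hdeg : ∀ v, G.degree v = 5) (x : V) :
    ∃ w : Fin 5 → V, Function.Injective w ∧ ∀ v, G.Adj x v ↔ ∃ i, w i = v := by
  have e := (G.neighborFinset x).equivFinOfCardEq (n := 5)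
    (by rw [card_neighborFinset_eq_degree, hdeg])
  refine ⟨fun i => e.symm i, Subtype.val_injective.comp e.symm.injective, fun v =>
    ⟨fun h => ⟨e ⟨v, by simpa using h⟩, by simp⟩, ?_⟩⟩
  rintro ⟨i, rfl⟩
  exact (G.mem_neighborFinset _ _).1 (e.symm i).2

/-- When two vertices have at most two common neighbors, two sets of neighbors of `w` and `w'`
with at least four elements in total are not completely joined. -/
theorem exists_not_adj_of_card_inter_le_two
    (hk : ∀ u v, u ≠ v → #(G.neighborFinset u ∩ G.neighborFinset v) ≤ 2) {w w' : V}
    (hww : ¬ G.Adj w w') {X Y : Finset V} (hX : X ⊆ G.neighborFinset w)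
    (hY : Y ⊆ G.neighborFinset w') (hX0 : 0 < #X) (hY0 : 0 < #Y) (h4 : 4 ≤ #X + #Y) :
    ∃ p ∈ X, ∃ q ∈ Y, ¬ G.Adj p q := by
  by_contra! hall
  obtain ⟨p, hp⟩ := card_pos.1 hX0
  obtain ⟨q, hq⟩ := card_pos.1 hY0
  have h1 : #X ≤ 2 := by
    refine (card_le_card fun p hp => ?_).trans (hk q w ?_)
    · exact mem_inter.2 ⟨by simpa using (hall p hp q hq).symm, hX hp⟩
    · rintro rfl
      exact hww (by simpa [G.adj_comm] using hY hq)
  have h2 : #Y ≤ 2 := by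
    refine (card_le_card fun q hq => ?_).trans (hk p w' ?_)
    · exact mem_inter.2 ⟨by simpa using hall p hp q hq, hY hq⟩
    · rintro rfl
      exact hww (by simpa using hX hp)
  obtain ⟨p, hp, p', hp', hpp⟩ := one_lt_card.1 (show 1 < #X by omega)
  have h3 : insert w Y ⊆ G.neighborFinset p ∩ G.neighborFinset p' := by
    intro q hq
    rw [mem_insert] at hq
    rw [mem_inter, mem_neighborFinset, mem_neighborFinset]
    rcases hq with rfl | hq
    · have h5 := hX hp
      have h6 := hX hp'
      rw [mem_neighborFinset] at h5 h6
      exact ⟨h5.symm, h6.symm⟩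
    · exact ⟨hall p hp q hq, hall p' hp' q hq⟩
  have h5 := (card_le_card h3).trans (hk p p' hpp)
  rw [card_insert_of_notMem fun h => hww (by simpa [G.adj_comm] using hY h)] at h5
  omega

/-- Here `z` has weight at least 2 + 2 + 2 and the neighbors of `x` adjacent to `a` have weight at
least 5. With two far pairs, all palettes have at least 3 colors, two have 4 and that of `z` has 5.
-/
theorem exists_coloring_of_two_le_card_of_two_le_card (hG : G.Connected)
    (hdeg : ∀ v, G.degree v = 5) (hT : ∀ a b c, G.Adj a b → G.Adj a c → ¬ G.Adj b c)
    (hk : ∀ u v, u ≠ v → #(G.neighborFinset u ∩ G.neighborFinset v) ≤ 2)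
    {x z a a' : V} (hxz : G.Adj x z) (hza : G.Adj z a) (hza' : G.Adj z a') (hax : a ≠ x)
    (hax' : a' ≠ x) (haa : a ≠ a')
    (h2 : 2 ≤ #(G.neighborFinset a ∩ G.neighborFinset x))
    (h2' : 2 ≤ #(G.neighborFinset a' ∩ G.neighborFinset x)) :
    ∃ c : Sym2 V → Fin 37, ProperOn G.EdgesWithinTwo G.edgeFinset c := by
  obtain ⟨w, hw, hxw⟩ := exists_equiv_neighborFinset hdeg x
  replace hxw : ∀ i, G.Adj x (w i) := fun i => (hxw _).2 ⟨i, rfl⟩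
  have hN : ∀ v, #(G.neighborFinset v) = 5 := fun v => by
    rw [card_neighborFinset_eq_degree, hdeg]
  -- The private neighborhoods of `w i` and `w j` are disjoint and have at least three elements
  -- each; deleting `P` leaves both nonempty and four elements in total.
  have pair : ∀ i j, i ≠ j → ∀ P : Finset V, #P ≤ 2 → ∃ p q, p ∉ P ∧ q ∉ P ∧ G.Adj (w i) p ∧
      G.Adj (w j) q ∧ p ≠ x ∧ q ≠ x ∧ G.FarPair (w i) p (w j) q := by
    intro i j hij P hP
    set X := G.neighborFinset (w i) \ G.neighborFinset (w j) with hX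
    set Y := G.neighborFinset (w j) \ G.neighborFinset (w i) with hY
    have hXc : 3 ≤ #X := by
      have h := card_sdiff_add_card_inter (G.neighborFinset (w i)) (G.neighborFinset (w j))
      rw [← hX] at h
      have := hk _ _ (hw.ne hij)
      have := hN (w i)
      omega
    have hYc : 3 ≤ #Y := by
      have h := card_sdiff_add_card_inter (G.neighborFinset (w j)) (G.neighborFinset (w i))
      rw [← hY] at h
      have := hk _ _ (hw.ne hij.symm)
      have := hN (w j)
      omega
    have hd : Disjoint X Y := by
      rw [Finset.disjoint_left]
      intro v hv hv'
      exact (mem_sdiff.1 hv).2 (mem_sdiff.1 hv').1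
    have h1 := card_sdiff_add_card_inter X P
    have h3 := card_sdiff_add_card_inter Y P
    have h4 : #(X ∩ P) + #(Y ∩ P) ≤ #P := by
      rw [← card_union_of_disjoint (hd.mono inter_subset_left inter_subset_left)]
      exact card_le_card (union_subset inter_subset_right inter_subset_right)
    obtain ⟨p, hp, q, hq, hpq⟩ := exists_not_adj_of_card_inter_le_two hk
      (hT x _ _ (hxw i) (hxw j)) (X := X \ P) (Y := Y \ P)
      (sdiff_subset.trans sdiff_subset) (sdiff_subset.trans sdiff_subset)
      (by omega) (by omega) (by omega)
    simp only [hX, hY, mem_sdiff, mem_neighborFinset] at hp hq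
    refine ⟨p, q, hp.2, hq.2, hp.1.1, hq.1.1, ?_, ?_, hw.ne hij, ?_,
      fun h => hp.1.2 h.symm, fun h => hq.1.2 h.symm, hpq⟩
    · rintro rfl
      exact hp.1.2 (hxw j).symm
    · rintro rfl
      exact hq.1.2 (hxw i).symm
    · rintro rfl
      exact hp.1.2 hq.1.1
  obtain ⟨p, q, -, -, hp, hq, hpx, hqx, hpq⟩ := pair 0 1 (by decide) ∅ (by simp)
  obtain ⟨p', q', hpn, hqn, hp', hq', hpx', hqx', hpq'⟩ := pair 2 3 (by decide) {p, q} card_le_two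
  simp only [mem_insert, mem_singleton, not_or] at hpn hqn
  have n₁ := hpq.ne'
  have n₂ := hpq'.ne'
  refine exists_coloring_of_two_farPairs hG hdeg hT (x := x) (w := w ∘ Fin.castSucc)
    (a := ![p, q, p', q']) (fun i => hxw _) ?_ ?_ (hw.comp (Fin.castSucc_injective _)) ?_
    hpq hpq' fun j hj => ?_
  · simp [Fin.forall_fin_succ, *]
  · simp [Fin.forall_fin_succ, *]
  · simp [Fin.forall_fin_succ, Function.Injective, n₁, n₁.symm, n₂, n₂.symm, hpn, hqn,
      Ne.symm hpn.1, Ne.symm hpn.2, Ne.symm hqn.1, Ne.symm hqn.2]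
  rcases Nat.lt_or_ge j 3 with hj3 | hj3
  · refine ⟨_, subset_rfl, ?_, fun v hv => ?_⟩
    · rw [hN]
      omega
    · have := four_le_rootWeight hdeg ((G.mem_neighborFinset _ _).1 hv)
      omega
  have hz := card_add_card_add_two_le_rootWeight hdeg hxz hza hax hza' hax' haa
  rcases Nat.lt_or_ge j 4 with hj4 | hj4
  · refine ⟨_, inter_subset_right (s₁ := G.neighborFinset a), by omega, fun v hv => ?_⟩
    rw [mem_inter, mem_neighborFinset, mem_neighborFinset] at hv
    have := card_add_three_le_rootWeight hdeg hv.2 hv.1.symm hax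
    omega
  · refine ⟨{z}, by simpa using hxz, by rw [card_singleton]; omega, fun v hv => ?_⟩
    rw [mem_singleton] at hv
    subst hv
    omega

/-- Five precolored edges, split three and two, use two colors and save three. All palettes then
have at least 4 colors, and that of `z` has 5. -/
theorem exists_coloring_of_disjoint_neighbors (hG : G.Connected)
    (hdeg : ∀ v, G.degree v = 5) (hT : ∀ a b c, G.Adj a b → G.Adj a c → ¬ G.Adj b c)
    (hk : ∀ u v, u ≠ v → #(G.neighborFinset u ∩ G.neighborFinset v) ≤ 2)
    {x z : V} (hxz : G.Adj x z) (hz5 : 5 ≤ G.rootWeight x z) (w : Fin 5 → V)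
    (hw : Function.Injective w) (hxw : ∀ i, G.Adj x (w i))
    (hd : ∀ i j : Fin 5, i ≠ j → (i < 3 ↔ j < 3) →
      ∀ a, a ≠ x → G.Adj (w i) a → ¬ G.Adj (w j) a) :
    ∃ c : Sym2 V → Fin 37, ProperOn G.EdgesWithinTwo G.edgeFinset c := by
  have hA : ∀ i, #((G.neighborFinset (w i)).erase x) = 4 := fun i => by
    rw [card_erase_of_mem (by simpa using (hxw i).symm), card_neighborFinset_eq_degree, hdeg]
  have hww : ∀ i j, ¬ G.Adj (w i) (w j) := fun i j => hT x _ _ (hxw i) (hxw j)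
  have hne : ∀ i j a, G.Adj (w i) a → a ≠ w j := by
    rintro i j a h rfl
    exact hww i j h
  have hleft : ∀ i j a, G.Adj (w i) a →
      2 ≤ #((G.neighborFinset (w j)).erase x \ G.neighborFinset a) := by
    intro i j a h
    have h1 := card_sdiff_add_card_inter ((G.neighborFinset (w j)).erase x) (G.neighborFinset a)
    have h2 : #((G.neighborFinset (w j)).erase x ∩ G.neighborFinset a) ≤ 2 :=
      (card_le_card (inter_subset_inter_right (erase_subset _ _))).trans
        (hk _ _ (hne i j a h).symm)
    have := hA j
    omega
  obtain ⟨a, ha⟩ := card_pos.1 (show 0 < #((G.neighborFinset (w 0)).erase x) by rw [hA]; omega)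
  rw [mem_erase, mem_neighborFinset] at ha
  -- Otherwise two non-neighbors of `a` at `w 1` would share `w 1` and two non-neighbors of `a` at
  -- `w 2`.
  obtain ⟨b, c, hwb, hbx, hab, hwc, hcx, hac, hbc⟩ : ∃ b c, G.Adj (w 1) b ∧ b ≠ x ∧
      ¬ G.Adj a b ∧ G.Adj (w 2) c ∧ c ≠ x ∧ ¬ G.Adj a c ∧ ¬ G.Adj b c := by
    by_contra! hall
    obtain ⟨b, hb, b', hb', hbb⟩ := one_lt_card.1 (hleft 0 1 a ha.2)
    simp only [mem_sdiff, mem_erase, mem_neighborFinset] at hb hb'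
    have h1 : insert (w 1) ((G.neighborFinset (w 2)).erase x \ G.neighborFinset a) ⊆
        G.neighborFinset b ∩ G.neighborFinset b' := by
      intro c hc
      simp only [mem_insert, mem_sdiff, mem_erase, mem_neighborFinset, mem_inter] at hc ⊢
      rcases hc with rfl | ⟨⟨hcx, hc⟩, hac⟩
      · exact ⟨hb.1.2.symm, hb'.1.2.symm⟩
      · exact ⟨hall b c hb.1.2 hb.1.1 hb.2 hc hcx hac,
          hall b' c hb'.1.2 hb'.1.1 hb'.2 hc hcx hac⟩
    have h2 := (card_le_card h1).trans (hk b b' hbb)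
    rw [card_insert_of_notMem (by simp [hww])] at h2
    have := hleft 0 2 a ha.2
    omega
  obtain ⟨p, hp, q, hq, hpq⟩ : ∃ p ∈ (G.neighborFinset (w 3)).erase x \ {a, b, c},
      ∃ q ∈ (G.neighborFinset (w 4)).erase x \ {a, b, c}, ¬ G.Adj p q := by
    set X := (G.neighborFinset (w 3)).erase x with hX
    set Y := (G.neighborFinset (w 4)).erase x with hY
    have hdXY : Disjoint X Y := by
      rw [Finset.disjoint_left]
      intro v hv hv'
      rw [mem_erase, mem_neighborFinset] at hv hv'
      exact hd 3 4 (by decide) (by decide) v hv.1 hv.2 hv'.2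
    have h1 := card_sdiff_add_card_inter X {a, b, c}
    have h3 := card_sdiff_add_card_inter Y {a, b, c}
    have h4 : #(X ∩ {a, b, c}) + #(Y ∩ {a, b, c}) ≤ 3 := by
      rw [← card_union_of_disjoint (hdXY.mono inter_subset_left inter_subset_left)]
      exact (card_le_card (union_subset inter_subset_right inter_subset_right)).trans card_le_three
    have hX4 : #X = 4 := hA 3
    have hY4 : #Y = 4 := hA 4
    exact exists_not_adj_of_card_inter_le_two hk (hww 3 4)
      (sdiff_subset.trans (erase_subset _ _)) (sdiff_subset.trans (erase_subset _ _))
      (by omega) (by omega) (by omega)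
  simp only [mem_sdiff, mem_erase, mem_neighborFinset, mem_insert, mem_singleton, not_or] at hp hq
  obtain ⟨⟨hpx, hwp⟩, hpa, hpb, hpc⟩ := hp
  obtain ⟨⟨hqx, hwq⟩, hqa, hqb, hqc⟩ := hq
  have d₀ : ∀ j : Fin 5, j ≠ 0 → j < 3 → ¬ G.Adj (w j) a := fun j hj h =>
    hd 0 j hj.symm (by simp [h]) a ha.1 ha.2
  have d₁ : ∀ j : Fin 5, j ≠ 1 → j < 3 → ¬ G.Adj (w j) b := fun j hj h =>
    hd 1 j hj.symm (by simp [h]) b hbx hwb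
  have d₂ : ∀ j : Fin 5, j ≠ 2 → j < 3 → ¬ G.Adj (w j) c := fun j hj h =>
    hd 2 j hj.symm (by simp [h]) c hcx hwc
  have d₃ : ¬ G.Adj (w 4) p := hd 3 4 (by decide) (by decide) p hpx hwp
  have d₄ : ¬ G.Adj (w 3) q := hd 4 3 (by decide) (by decide) q hqx hwq
  have nab : a ≠ b := by rintro rfl; exact d₀ 1 (by decide) (by decide) hwb
  have nac : a ≠ c := by rintro rfl; exact d₀ 2 (by decide) (by decide) hwc
  have nbc : b ≠ c := by rintro rfl; exact d₁ 2 (by decide) (by decide) hwc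
  have npq : p ≠ q := by rintro rfl; exact d₃ hwq
  have ds : ∀ {u v : V}, ¬ G.Adj u v → ¬ G.Adj v u := fun h h' => h h'.symm
  refine exists_coloring_of_root hG hdeg hT x 3 w ![a, b, c, p, q] ![0, 0, 0, 1, 1] hxw ?_ ?_ hw ?_
    ?_ (by decide) (card_filter_rootWeight_le hdeg fun j hj => ?_)
  · intro i
    fin_cases i
    exacts [ha.2, hwb, hwc, hwp, hwq]
  · intro i
    fin_cases i
    exacts [ha.1, hbx, hcx, hpx, hqx]
  · simp [Fin.forall_fin_succ, Function.Injective, nab, nab.symm, nac, nac.symm, nbc, nbc.symm,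
      npq, npq.symm, hpa, hpb, hpc, hqa, hqb, hqc, Ne.symm hpa, Ne.symm hpb, Ne.symm hpc,
      Ne.symm hqa, Ne.symm hqb, Ne.symm hqc]
  · intro i j hij hc
    fin_cases i <;> fin_cases j <;> first
      | exact absurd rfl hij
      | exact absurd hc (by decide)
      | skip
    exacts [⟨ds (d₀ 1 (by decide) (by decide)), hab⟩, ⟨ds (d₀ 2 (by decide) (by decide)), hac⟩,
      ⟨ds (d₁ 0 (by decide) (by decide)), ds hab⟩, ⟨ds (d₁ 2 (by decide) (by decide)), hbc⟩,
      ⟨ds (d₂ 0 (by decide) (by decide)), ds hac⟩, ⟨ds (d₂ 1 (by decide) (by decide)), ds hbc⟩,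
      ⟨ds d₃, hpq⟩, ⟨ds d₄, ds hpq⟩]
  rcases Nat.lt_or_ge j 4 with hj4 | hj4
  · refine ⟨_, subset_rfl, ?_, fun v hv => ?_⟩
    · rw [card_neighborFinset_eq_degree, hdeg]
      omega
    · have := four_le_rootWeight hdeg ((G.mem_neighborFinset _ _).1 hv)
      omega
  · refine ⟨{z}, by simpa using hxz, by rw [card_singleton]; omega, fun v hv => ?_⟩
    rw [mem_singleton] at hv
    subst hv
    omega

/-- By the two-pair case, each neighbor of `x` may be assumed to have at most one neighbor besides
`x` in common with the others. For `z₁` and `z₂` it is `y`. If two of the `w`'s share nothing but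
`x`, the three-two split applies; if every two share a vertex, uniqueness makes it the same vertex,
of codegree 3 with `x`. -/
theorem exists_coloring_of_card_inter_eq_two (hG : G.Connected) (hdeg : ∀ v, G.degree v = 5)
    (hT : ∀ a b c, G.Adj a b → G.Adj a c → ¬ G.Adj b c) {x y : V} (hxy : x ≠ y)
    (hk : ∀ u v, u ≠ v → #(G.neighborFinset u ∩ G.neighborFinset v) ≤ 2)
    (h2 : #(G.neighborFinset x ∩ G.neighborFinset y) = 2) :
    ∃ c : Sym2 V → Fin 37, ProperOn G.EdgesWithinTwo G.edgeFinset c := by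
  by_contra hno
  have huniq : ∀ z a a', G.Adj x z → G.Adj z a → G.Adj z a' → a ≠ x → a' ≠ x →
      2 ≤ #(G.neighborFinset a ∩ G.neighborFinset x) →
      2 ≤ #(G.neighborFinset a' ∩ G.neighborFinset x) → a = a' := by
    intro z a a' hxz hza hza' hax hax' h h'
    by_contra haa
    exact hno (exists_coloring_of_two_le_card_of_two_le_card hG hdeg hT hk hxz hza hza' hax hax'
      haa h h')
  obtain ⟨z₁, z₂, hz, hZ⟩ := card_eq_two.1 h2
  have hW : #(G.neighborFinset x \ (G.neighborFinset x ∩ G.neighborFinset y)) = 3 := by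
    rw [card_sdiff_of_subset inter_subset_left, card_neighborFinset_eq_degree, hdeg, h2]
  obtain ⟨w₁, w₂, w₃, hw₁₂, hw₁₃, hw₂₃, hW⟩ := card_eq_three.1 hW
  have hzmem : ∀ z, z = z₁ ∨ z = z₂ → G.Adj x z ∧ G.Adj y z := by
    intro z hz
    have : z ∈ G.neighborFinset x ∩ G.neighborFinset y := by simpa [hZ] using hz
    simpa using this
  have hwmem : ∀ w, w = w₁ ∨ w = w₂ ∨ w = w₃ → G.Adj x w ∧ ¬ G.Adj y w := by
    intro w hw
    have : w ∈ G.neighborFinset x \ (G.neighborFinset x ∩ G.neighborFinset y) := by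
      simpa [hW] using hw
    simp only [mem_sdiff, mem_inter, mem_neighborFinset, not_and] at this
    exact ⟨this.1, this.2 this.1⟩
  have hzw : ∀ z w, (z = z₁ ∨ z = z₂) → (w = w₁ ∨ w = w₂ ∨ w = w₃) → z ≠ w := by
    rintro z w hz hw rfl
    exact (hwmem z hw).2 (hzmem z hz).2
  have hdzw : ∀ z w, (z = z₁ ∨ z = z₂) → (w = w₁ ∨ w = w₂ ∨ w = w₃) →
      ∀ a, a ≠ x → G.Adj z a → ¬ G.Adj w a := by
    intro z w hz hw a hax hza hwa
    have hay : a = y := huniq z a y (hzmem z hz).1 hza (hzmem z hz).2.symm hax hxy.symm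
      (two_le_card_inter_neighborFinset (hzmem z hz).1 (hwmem w hw).1 (hzw z w hz hw) hza hwa)
      (by rw [inter_comm]; exact h2.ge)
    subst hay
    exact (hwmem w hw).2 hwa.symm
  have main : ∀ u v t, (u = w₁ ∨ u = w₂ ∨ u = w₃) → (v = w₁ ∨ v = w₂ ∨ v = w₃) →
      (t = w₁ ∨ t = w₂ ∨ t = w₃) → u ≠ v → u ≠ t → v ≠ t →
      ∃ a, a ≠ x ∧ G.Adj u a ∧ G.Adj v a := by
    intro u v t hu hv ht huv hut hvt
    by_contra! hd
    refine hno (exists_coloring_of_disjoint_neighbors hG hdeg hT hk (hzmem z₁ (Or.inl rfl)).1 ?_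
      ![z₁, u, v, z₂, t] ?_ ?_ ?_)
    · have := card_add_three_le_rootWeight hdeg (hzmem z₁ (Or.inl rfl)).1
        (hzmem z₁ (Or.inl rfl)).2.symm hxy.symm
      rw [inter_comm] at this
      omega
    · have a₁ := hzw z₁ u (Or.inl rfl) hu
      have a₂ := hzw z₁ v (Or.inl rfl) hv
      have a₃ := hzw z₁ t (Or.inl rfl) ht
      have b₁ := hzw z₂ u (Or.inr rfl) hu
      have b₂ := hzw z₂ v (Or.inr rfl) hv
      have b₃ := hzw z₂ t (Or.inr rfl) ht
      simp [Fin.forall_fin_succ, Function.Injective, a₁, a₂, a₃, b₁, b₂, b₃, a₁.symm, a₂.symm,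
        a₃.symm, b₁.symm, b₂.symm, b₃.symm, hz, hz.symm, huv, hut, hvt, huv.symm, hut.symm,
        hvt.symm]
    · intro i
      fin_cases i
      exacts [(hzmem _ (Or.inl rfl)).1, (hwmem _ hu).1, (hwmem _ hv).1, (hzmem _ (Or.inr rfl)).1,
        (hwmem _ ht).1]
    · have e₁ := hdzw z₁ u (Or.inl rfl) hu
      have e₂ := hdzw z₁ v (Or.inl rfl) hv
      have e₃ := hdzw z₂ t (Or.inr rfl) ht
      have ds : ∀ {u v : V}, (∀ a, a ≠ x → G.Adj u a → ¬ G.Adj v a) →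
          ∀ a, a ≠ x → G.Adj v a → ¬ G.Adj u a := fun h a hax h1 h2 => h a hax h2 h1
      intro i j hij hc
      fin_cases i <;> fin_cases j <;> first
        | exact absurd rfl hij
        | exact absurd hc (by decide)
        | skip
      exacts [e₁, e₂, ds e₁, hd, ds e₂, ds hd, e₃, ds e₃]
  obtain ⟨a, hax, ha₁, ha₂⟩ := main w₁ w₂ w₃ (by simp) (by simp) (by simp) hw₁₂ hw₁₃ hw₂₃
  obtain ⟨b, hbx, hb₁, hb₃⟩ := main w₁ w₃ w₂ (by simp) (by simp) (by simp) hw₁₃ hw₁₂ hw₂₃.symm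
  have h₁ := (hwmem w₁ (by simp)).1
  have h₂ := (hwmem w₂ (by simp)).1
  have h₃ := (hwmem w₃ (by simp)).1
  have hab : a = b := huniq w₁ a b h₁ ha₁ hb₁ hax hbx
    (two_le_card_inter_neighborFinset h₁ h₂ hw₁₂ ha₁ ha₂)
    (two_le_card_inter_neighborFinset h₁ h₃ hw₁₃ hb₁ hb₃)
  subst hab
  have h3 : ({w₁, w₂, w₃} : Finset V) ⊆ G.neighborFinset a ∩ G.neighborFinset x := by
    intro w hw
    simp only [mem_insert, mem_singleton] at hw
    rcases hw with rfl | rfl | rfl <;> simp [*, G.adj_comm a]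
  have h4 := (card_le_card h3).trans (hk a x hax)
  rw [card_eq_three.2 ⟨w₁, w₂, w₃, hw₁₂, hw₁₃, hw₂₃, rfl⟩] at h4
  omega

/-! ### Maximum codegree at most one. -/

/-- An independent transversal of the disjoint 4-sets `A i` gives five edges of one color, saving
four, so all palettes have five colors. A vertex of `A i` has at most one neighbor in `A j`. -/
theorem exists_coloring_of_card_inter_le_one (hG : G.Connected) (hdeg : ∀ v, G.degree v = 5)
    (hT : ∀ a b c, G.Adj a b → G.Adj a c → ¬ G.Adj b c)
    (hk : ∀ u v, u ≠ v → #(G.neighborFinset u ∩ G.neighborFinset v) ≤ 1) :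
    ∃ c : Sym2 V → Fin 37, ProperOn G.EdgesWithinTwo G.edgeFinset c := by
  obtain ⟨x⟩ := hG.nonempty
  obtain ⟨w, hw, hxw⟩ := exists_equiv_neighborFinset hdeg x
  replace hxw : ∀ i, G.Adj x (w i) := fun i => (hxw _).2 ⟨i, rfl⟩
  set A : Fin 5 → Finset V := fun i => (G.neighborFinset (w i)).erase x with hA
  have memA : ∀ {i a}, a ∈ A i ↔ a ≠ x ∧ G.Adj (w i) a := fun {i a} => by
    rw [hA, mem_erase, mem_neighborFinset]
  have cardA : ∀ i, #(A i) = 4 := fun i => by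
    rw [hA, card_erase_of_mem (by simpa using (hxw i).symm), card_neighborFinset_eq_degree, hdeg]
  have hprivate : ∀ {i j a}, a ∈ A i → G.Adj a (w j) → i = j := by
    intro i j a ha h
    rw [memA] at ha
    by_contra hij
    have h1 := two_le_card_inter_neighborFinset (hxw i) (hxw j) (hw.ne hij) ha.2 h.symm
    have h2 := hk a x ha.1
    omega
  have hone : ∀ {i j a}, a ∈ A i → #(G.neighborFinset a ∩ A j) ≤ 1 := by
    intro i j a ha
    refine (card_le_card (inter_subset_inter_left (erase_subset _ _))).trans (hk a (w j) ?_)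
    rintro rfl
    exact hT x _ _ (hxw i) (hxw j) (memA.1 ha).2
  have hpick : ∀ (j : Fin 5) (B : Finset V), #(B ∩ A j) ≤ 3 → ∃ c ∈ A j, c ∉ B := by
    intro j B hB
    obtain ⟨c, hc, hcB⟩ := exists_mem_notMem_of_card_lt_card
      (show #(B ∩ A j) < #(A j) by rw [cardA]; omega)
    exact ⟨c, hc, fun h => hcB (mem_inter.2 ⟨h, hc⟩)⟩
  have hunion : ∀ (B C : Finset V) j, #((B ∪ C) ∩ A j) ≤ #(B ∩ A j) + #(C ∩ A j) := by
    intro B C j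
    rw [union_inter_distrib_right]
    exact card_union_le _ _
  -- A purely greedy transversal could be blocked at `A 4`, where four vertices may forbid all four
  -- choices. So `a` and `b` are picked to forbid at most one between them. If all of `A 0` has
  -- neighbors in `A 4`, these form a perfect matching, and a neighbor of `b` in `A 4` can be shared
  -- with some `a`; without triangles, `a` and `b` are then nonadjacent.
  obtain ⟨a, ha, b, hb, hab, hab4⟩ : ∃ a ∈ A 0, ∃ b ∈ A 1, ¬ G.Adj a b ∧
      #((G.neighborFinset a ∪ G.neighborFinset b) ∩ A 4) ≤ 1 := by
    by_cases h0 : ∃ a ∈ A 0, G.neighborFinset a ∩ A 4 = ∅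
    · obtain ⟨a, ha, ha4⟩ := h0
      obtain ⟨b, hb, hab⟩ := hpick 1 (G.neighborFinset a) ((hone ha).trans (by omega))
      refine ⟨a, ha, b, hb, by simpa using hab, (hunion _ _ _).trans ?_⟩
      rw [ha4, card_empty, zero_add]
      exact hone hb
    push Not at h0
    choose! f hf using h0
    simp only [mem_inter, mem_neighborFinset] at hf
    obtain ⟨b, hb⟩ := card_pos.1 (show 0 < #(A 1) by rw [cardA]; omega)
    have hfinj : Set.InjOn f (A 0) := by
      intro a ha a' ha' hfa
      have h2 := hone (j := 0) (hf a ha).2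
      refine card_le_one.1 h2 a ?_ a' ?_
      · exact mem_inter.2 ⟨by simpa using (hf a ha).1.symm, ha⟩
      · rw [hfa]
        exact mem_inter.2 ⟨by simpa using (hf a' ha').1.symm, ha'⟩
    have himage : (A 0).image f = A 4 :=
      eq_of_subset_of_card_le (image_subset_iff.2 fun a ha => (hf a ha).2)
        (by rw [card_image_of_injOn hfinj, cardA, cardA])
    rcases (G.neighborFinset b ∩ A 4).eq_empty_or_nonempty with hb4 | ⟨e, he⟩
    · obtain ⟨a, ha, hab⟩ := hpick 0 (G.neighborFinset b) ((hone hb).trans (by omega))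
      refine ⟨a, ha, b, hb, by simpa [G.adj_comm] using hab, (hunion _ _ _).trans ?_⟩
      rw [hb4, card_empty, add_zero]
      exact hone ha
    · rw [mem_inter, mem_neighborFinset] at he
      obtain ⟨a, ha, rfl⟩ := mem_image.1 (himage ▸ he.2)
      refine ⟨a, ha, b, hb, hT _ _ _ (hf a ha).1.symm he.1.symm, ?_⟩
      have heq : ∀ v ∈ (G.neighborFinset a ∪ G.neighborFinset b) ∩ A 4, v = f a := by
        intro v hv
        rw [mem_inter, mem_union] at hv
        rcases hv with ⟨hv | hv, hv4⟩
        · exact card_le_one.1 (hone (j := 4) ha) _ (mem_inter.2 ⟨hv, hv4⟩) _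
            (mem_inter.2 ⟨by simpa using (hf a ha).1, he.2⟩)
        · exact card_le_one.1 (hone (j := 4) hb) _ (mem_inter.2 ⟨hv, hv4⟩) _
            (mem_inter.2 ⟨by simpa using he.1, he.2⟩)
      exact card_le_one.2 fun u hu v hv => (heq u hu).trans (heq v hv).symm
  obtain ⟨c, hc, hcn⟩ := hpick 2 (G.neighborFinset a ∪ G.neighborFinset b) (by
    have := hunion (G.neighborFinset a) (G.neighborFinset b) 2
    have := hone (j := 2) ha
    have := hone (j := 2) hb
    omega)
  obtain ⟨d, hd, hdn⟩ := hpick 3 ((G.neighborFinset a ∪ G.neighborFinset b) ∪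
    G.neighborFinset c) (by
    have := hunion (G.neighborFinset a) (G.neighborFinset b) 3
    have := hunion (G.neighborFinset a ∪ G.neighborFinset b) (G.neighborFinset c) 3
    have := hone (j := 3) ha
    have := hone (j := 3) hb
    have := hone (j := 3) hc
    omega)
  obtain ⟨e, he, hen⟩ := hpick 4 (((G.neighborFinset a ∪ G.neighborFinset b) ∪
    G.neighborFinset c) ∪ G.neighborFinset d) (by
    have := hunion (G.neighborFinset a ∪ G.neighborFinset b) (G.neighborFinset c) 4
    have := hunion ((G.neighborFinset a ∪ G.neighborFinset b) ∪ G.neighborFinset c)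
      (G.neighborFinset d) 4
    have := hone (j := 4) hc
    have := hone (j := 4) hd
    omega)
  simp only [mem_union, mem_neighborFinset, not_or] at hcn hdn hen
  have hu : ∀ i, ![a, b, c, d, e] i ∈ A i := by
    intro i
    fin_cases i
    exacts [ha, hb, hc, hd, he]
  have hindep : ∀ i j, ¬ G.Adj (![a, b, c, d, e] i) (![a, b, c, d, e] j) := by
    simp [Fin.forall_fin_succ, hab, hcn, hdn, hen, G.adj_comm b a, G.adj_comm c a,
      G.adj_comm c b, G.adj_comm d a, G.adj_comm d b, G.adj_comm d c, G.adj_comm e a,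
      G.adj_comm e b, G.adj_comm e c, G.adj_comm e d]
  refine exists_coloring_of_root hG hdeg hT x 4 w ![a, b, c, d, e] (fun _ => 0) hxw
    (fun i => (memA.1 (hu i)).2) (fun i => (memA.1 (hu i)).1) hw ?_ ?_ (by decide)
    (card_filter_rootWeight_le hdeg fun j hj => ⟨_, subset_rfl, ?_, fun v hv => ?_⟩)
  · intro i j hij
    exact hprivate (hu i) (hij ▸ (memA.1 (hu j)).2.symm)
  · exact fun i j hij _ => ⟨fun h => hij (hprivate (hu i) h), hindep i j⟩
  · rw [card_neighborFinset_eq_degree, hdeg]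
    omega
  · have := four_le_rootWeight hdeg ((G.mem_neighborFinset _ _).1 hv)
    omega

/-! ### Assembly of the cases, and passage to components. -/

/-- A connected graph with maximum degree at most five has a strong edge-coloring with
37 colors. -/
theorem Connected.exists_coloring (hG : G.Connected) (hΔ : ∀ v, G.degree v ≤ 5) :
    ∃ c : Sym2 V → Fin 37, ProperOn G.EdgesWithinTwo G.edgeFinset c := by
  by_cases hdeg : ∃ v, G.degree v ≤ 4
  · obtain ⟨v, hv⟩ := hdeg
    exact exists_coloring_of_degree_le_four hG hΔ v hv
  replace hdeg : ∀ v, G.degree v = 5 := fun v => by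
    have := hΔ v
    have := not_exists.1 hdeg v
    omega
  by_cases hT : ∃ a b c, G.Adj a b ∧ G.Adj a c ∧ G.Adj b c
  · obtain ⟨a, b, c, hab, hac, hbc⟩ := hT
    exact exists_coloring_of_triangle hG hΔ hab hac hbc
  push Not at hT
  by_cases hk : ∀ u v, u ≠ v → #(G.neighborFinset u ∩ G.neighborFinset v) ≤ 1
  · exact exists_coloring_of_card_inter_le_one hG hdeg hT hk
  push Not at hk
  obtain ⟨u, v, huv, huv1⟩ := hk
  obtain ⟨⟨x, y⟩, hxy, hmax⟩ := exists_max_image ({p : V × V | p.1 ≠ p.2} : Finset (V × V))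
    (fun p => #(G.neighborFinset p.1 ∩ G.neighborFinset p.2)) ⟨(u, v), by simpa using huv⟩
  replace hxy : x ≠ y := by simpa using hxy
  replace hmax : ∀ u v, u ≠ v → #(G.neighborFinset u ∩ G.neighborFinset v) ≤
      #(G.neighborFinset x ∩ G.neighborFinset y) := fun u v h => hmax (u, v) (by simpa using h)
  have h1 := hmax u v huv
  rcases Nat.lt_or_ge 4 #(G.neighborFinset x ∩ G.neighborFinset y) with h5 | h4
  · exact exists_coloring_of_card_inter_eq_five hG hdeg hT hxy h5
  have hcases : #(G.neighborFinset x ∩ G.neighborFinset y) = 2 ∨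
      #(G.neighborFinset x ∩ G.neighborFinset y) = 3 ∨
      #(G.neighborFinset x ∩ G.neighborFinset y) = 4 := by omega
  rcases hcases with h | h | h <;> rw [h] at hmax
  · exact exists_coloring_of_card_inter_eq_two hG hdeg hT hxy hmax h
  · exact exists_coloring_of_card_inter_eq_three hG hdeg hT hxy hmax h
  · exact exists_coloring_of_card_inter_eq_four hG hdeg hT hxy (fun u hu => hmax u x hu) h

omit [DecidableEq V] in
/-- A graph with maximum degree at most five has a strong edge-coloring with 37 colors. -/
theorem exists_isStrong_of_maxDegree_le_five (hG : G.maxDegree ≤ 5) :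
    ∃ c : G.EdgeLabeling (Fin 37), c.IsStrong := by
  classical
  have hcomp : ∀ C : G.ConnectedComponent, ∃ c : Sym2 C → Fin 37,
      ProperOn C.toSimpleGraph.EdgesWithinTwo C.toSimpleGraph.edgeFinset c := by
    intro C
    refine C.connected_toSimpleGraph.exists_coloring fun v => ?_
    refine le_trans ?_ ((G.degree_le_maxDegree (v : V)).trans hG)
    rw [← card_neighborFinset_eq_degree, ← card_neighborFinset_eq_degree]
    refine card_le_card_of_injOn Subtype.val (fun u hu => ?_) Subtype.val_injective.injOn
    rw [mem_coe, mem_neighborFinset] at hu ⊢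
    exact hu
  choose c hc using hcomp
  have hinj : ∀ C : G.ConnectedComponent,
      Function.Injective (Sym2.map (Subtype.val : C → V)) :=
    fun C => Sym2.map.injective Subtype.val_injective
  have hlift : ∀ e ∈ G.edgeSet, ∀ x ∈ e, ∃ e' ∈ (G.connectedComponentMk x).toSimpleGraph.edgeSet,
      Sym2.map Subtype.val e' = e := by
    rintro e he x ⟨v, rfl⟩
    have hv : G.connectedComponentMk v = G.connectedComponentMk x :=
      (ConnectedComponent.connectedComponentMk_eq_of_adj he).symm
    exact ⟨s(⟨x, rfl⟩, ⟨v, hv⟩), he, rfl⟩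
  have hmk : ∀ e ∈ G.edgeSet, ∀ x ∈ e, ∀ y ∈ e,
      G.connectedComponentMk x = G.connectedComponentMk y := by
    rintro e he x ⟨v, rfl⟩ y hy
    rcases Sym2.mem_iff.1 hy with rfl | rfl
    · rfl
    · exact ConnectedComponent.connectedComponentMk_eq_of_adj he
  -- The component is read off from an arbitrary endpoint, harmlessly by `hmk`; the default 0 is
  -- never taken on an edge.
  refine ⟨fun e => Function.extend (Sym2.map Subtype.val)
    (c (G.connectedComponentMk (Quot.out (e : Sym2 V)).1)) (fun _ => 0) (e : Sym2 V), ?_⟩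
  rintro ⟨e, he⟩ ⟨f, hf⟩ hef ⟨x, hx, y, hy, hxy⟩
  replace hx : x ∈ e := hx
  replace hy : y ∈ f := hy
  have hxy' : G.connectedComponentMk y = G.connectedComponentMk x := by
    rcases hxy with rfl | h
    · rfl
    · exact (ConnectedComponent.connectedComponentMk_eq_of_adj h).symm
  obtain ⟨e', he', hee⟩ := hlift e he x hx
  have hf' := hlift f hf y hy
  rw [hxy'] at hf'
  obtain ⟨f', hf', hff⟩ := hf'
  simp only
  rw [hmk e he _ (Sym2.out_fst_mem e) x hx, (hmk f hf _ (Sym2.out_fst_mem f) y hy).trans hxy',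
    ← hee, ← hff, (hinj _).extend_apply, (hinj _).extend_apply]
  refine hc _ e' (mem_edgeFinset.2 he') f' (mem_edgeFinset.2 hf') ?_ ?_
  · rintro rfl
    exact hef (Subtype.ext (hee.symm.trans hff))
  · rw [← hee, Sym2.mem_map] at hx
    rw [← hff, Sym2.mem_map] at hy
    obtain ⟨x', hx', hxx⟩ := hx
    obtain ⟨y', hy', hyy⟩ := hy
    rw [← hxx, ← hyy] at hxy
    exact ⟨x', hx', y', hy', hxy.imp Subtype.ext id⟩

end SimpleGraph

theorem theorem1p3 {V : Type*} [Fintype V] (G : SimpleGraph V) [DecidableRel G.Adj]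
    (hG : G.maxDegree = 5) :
    ∃ c : G.EdgeLabeling (Fin 37), c.IsStrong := by
  exact SimpleGraph.exists_isStrong_of_maxDegree_le_five hG.le
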